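/- Let $d\ge 1$, let $E$ be the set of edges $\{u,v\}$, $\|u-v\|_1=1$, of the lattice $\mathbb{Z}^d$, and let $N(u)$ be the set of neighbours of $u$. Write $e\sim e'$ if the edges $e\ne e'$ share an end point. Let $\chi$ be a finite set of spin values, $H:\chi^2\to\mathbb{R}\cup\{\infty\}$ symmetric and $h:\chi\to\mathbb{R}$. In the edge model, a configuration $(s_e)\in\chi^{F}$ on a finite set $F\subset E$ has the weight $$w_F(s)=\exp\Big(-\sum_{\{e,e'\}\subset F,\ e\sim e'}H(s_e,s_{e'})-\sum_{e\in F}h(s_e)\Big),$$ with $\exp(-\infty)=0$; $\mathbb{P}_F$ is the probability measure on $\chi^F$ proportional to $w_F$. For a finite $\Lambda\subset\mathbb{Z}^d$ let $E(\Lambda)$ be the set of edges with both end points in $\Lambda$, and $Z_\Lambda=\sum_{s\in\chi^{E(\Lambda)}}w_{E(\Lambda)}(s)$. A Gibbs measure is a probability measure on $\chi^E$ whose conditional law in each finite set of edges, given the spins outside of it, is the one determined by these weights. For $X\subset E$ let $B_r(X)$ be the set of edges at distance at most $r$ from $X$ with respect to the relation $\sim$, and let $\partial_rX$ be the set of edges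 in $B_r(X)$ that are $\sim$-related to an edge outside of $B_r(X)$. Assume * (spin $s^*$) $s^*\in\chi$ satisfies $H(s,s^*)<\infty$ for all $s\in\chi$; * (strong spatial mixing) for every finite $X\subset E$ and every (possibly infinite) $Y\subset E$ there is a function $R$ with $R(r)\to0$ as $r\to\infty$, such that for all integers $r\ge1$ and all spin assignments $s^1$ on $X$, $s^2$ on $Y$, and $s^3,s^4$ on $\partial_rX$, $$\big|\mathbb{P}(\sigma_X=s^1\mid\sigma_Y=s^2,\sigma_{\partial_rX}=s^3)-\mathbb{P}(\sigma_X=s^1\mid\sigma_Y=s^2,\sigma_{\partial_rX}=s^4)\big|\le R(r),$$ whenever both conditions are feasible. Here the conditional probabilities are those of $\mathbb{P}_{B_r(X)}$, given the spins in $(Y\cap B_r(X))\cup\partial_rX$. Then there is exactly one Gibbs measure $\mathbb{P}$. Let $\prec$ be the lexicographic order on $\mathbb{Z}^d$ (last coordinate most significant), let $\mathcal{E}$ be the event that $\sigma_{(u,w)}=s^*$ for all $u\succ0$ and $w\in N(u)$, and let $\mathcal{E}_{\mathrm{even}}$ be the event that $\sigma_{(u,w)}=s^*$ for all $u\succ 0$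 with $\sum_iu_i$ even and $w\in N(u)$. The conditional probabilities of the event $\{\sigma_{(0,v)}=s^*\ \forall v\in N(0)\}$ given $\mathcal{E}$ and given $\mathcal{E}_{\mathrm{even}}$, defined as the limits of the conditional probabilities given that the spins in $F$ equal $s^*$ along the finite sets $F$ of the edges concerned, directed by inclusion, exist and are positive. The free energy $\mathcal{P}(d,H,h)=\lim_n \log Z_{\Lambda_n}/|\Lambda_n|$ exists and is the same for all sequences of finite non-empty sets $\Lambda_n\subset\mathbb{Z}^d$ such that $|\partial\Lambda_n|/|\Lambda_n|\to0$, where $\partial\Lambda=\{v\in\Lambda: N(v)\not\subset\Lambda\}$. Moreover, $$\mathcal{P}(d,H,h)=-\log\mathbb{P}\big(\sigma_{(0,v)}=s^*\ \forall v\in N(0)\mid\mathcal{E}\big)-d(2d-1)H(s^*,s^*)-d\,h(s^*)$$ $$\phantom{\mathcal{P}(d,H,h)}=-\tfrac12\log\mathbb{P}\big(\sigma_{(0,v)}=s^*\ \forall v\in N(0)\mid\mathcal{E}_{\mathrm{even}}\big)-d(2d-1)H(s^*,s^*)-d\,h(s^*).$$ -/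

import Mathlib

open Filter Topology MeasureTheory

namespace SpinSystem

/-! ### Pair interactions and Gibbs weights on finite induced subsystems -/

/-- A nearest neighbour spin model with spin values `χ`: a Hamiltonian `H` with values in
`ℝ ∪ {∞}` (symmetric, because it is evaluated on undirected pairs) and an external field `h`. -/
structure Model (χ : Type*) where
  H : χ → χ → WithTop ℝ
  symm : ∀ a b, H a b = H b a
  h : χ → ℝ

/-- `H` as a function of an unordered pair of spin values. -/
def Model.pair {χ : Type*} (M : Model χ) : Sym2 χ → WithTop ℝ :=
  Sym2.lift ⟨M.H, M.symm⟩

open Classical in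
/-- `exp (-x)` for `x ∈ ℝ ∪ {∞}`, with `exp (-∞) = 0`. -/
noncomputable def expNeg (x : WithTop ℝ) : ℝ :=
  if x = ⊤ then 0 else Real.exp (-(x.untopD 0))

section Finite

variable {V χ : Type*}

open Classical in
/-- The energy of the configuration `τ ∈ χ ^ A` in the subsystem induced by the finite set `A`:
the sum of `H` over the undirected edges of the induced subgraph, plus the sum of `h` over `A`. -/
noncomputable def energy (G : SimpleGraph V) (M : Model χ) (A : Finset V) (τ : A → χ) :
    WithTop ℝ :=
  (∑ e ∈ (G.comap (fun v : A => (v : V))).edgeFinset, M.pair (e.map τ))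
    + ∑ v : A, ((M.h (τ v) : ℝ) : WithTop ℝ)

/-- The Gibbs weight of a configuration on the finite set `A`. -/
noncomputable def weight (G : SimpleGraph V) (M : Model χ) (A : Finset V) (τ : A → χ) : ℝ :=
  expNeg (energy G M A τ)

open Classical in
/-- The total Gibbs weight of a set `S` of configurations on the finite set `A`. -/
noncomputable def weightOf [Fintype χ] (G : SimpleGraph V) (M : Model χ) (A : Finset V)
    (S : Set (A → χ)) : ℝ :=
  ∑ τ : A → χ with τ ∈ S, weight G M A τ

/-- The partition function `Z_A` of the subsystem induced by the finite set `A`. -/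
noncomputable def partitionFunction [Fintype χ] (G : SimpleGraph V) (M : Model χ)
    (A : Finset V) : ℝ :=
  weightOf G M A Set.univ

/-- The conditional probability `ℙ_A(S | T)` for the Gibbs measure `ℙ_A` of the finite subsystem
induced by `A` (the normalization by `Z_A` cancels).  It is meaningful if `weightOf G M A T ≠ 0`. -/
noncomputable def finCondProb [Fintype χ] (G : SimpleGraph V) (M : Model χ) (A : Finset V)
    (S T : Set (A → χ)) : ℝ :=
  weightOf G M A (S ∩ T) / weightOf G M A T

end Finite

/-! ### Gibbs measures on infinite graphs -/

section Infinite

variable {V χ : Type*}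

/-- `μ` is a Gibbs measure: whenever `Λ ⊆ Δ` are finite sets of sites and `Δ` contains all the
neighbours of `Λ`, the conditional law under `μ` of the spins in `Λ`, given the spins in `Δ \ Λ`,
is the one of the finite Gibbs measure on `Δ`.  (Given the spins in `Δ \ Λ`, that law only involves
the interactions inside `Λ` and those between `Λ` and its neighbours, so this is the usual
DLR condition.) -/
structure IsGibbsMeasure [Fintype χ] [MeasurableSpace χ] (G : SimpleGraph V) (M : Model χ)
    (μ : Measure (V → χ)) : Prop where
  isProbabilityMeasure : IsProbabilityMeasure μ
  dlr : ∀ Λ Δ : Finset V, Λ ⊆ Δ → (∀ v ∈ Λ, ∀ u, G.Adj v u → u ∈ Δ) → ∀ σ : V → χ,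
    μ.real {ω | ∀ v ∈ Δ, ω v = σ v} =
      finCondProb G M Δ {τ | ∀ v : Δ, (v : V) ∈ Λ → τ v = σ v}
          {τ | ∀ v : Δ, (v : V) ∉ Λ → τ v = σ v}
        * μ.real {ω | ∀ v ∈ Δ, v ∉ Λ → ω v = σ v}

/-- The conditional probability of the event `S` given that all the spins in the (possibly
infinite) set `Y` are equal to `s` exists and is equal to `p`.  As this event may have measure
zero, the conditional probability is the limit of the conditional probabilities given
that the spins in `F` are equal to `s`, along the finite subsets `F` of `Y` directed by
inclusion. -/
def HasCondProb [MeasurableSpace χ] (μ : Measure (V → χ)) (S : Set (V → χ)) (Y : Set V) (s : χ)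
    (p : ℝ) : Prop :=
  Tendsto (fun F : Finset Y =>
    (ProbabilityTheory.cond μ {ω | ∀ v ∈ F, ω (v : V) = s}).real S) atTop (𝓝 p)

/-! ### Strong spatial mixing -/

/-- `B_r(X)`: the set of nodes at graph distance at most `r` from `X`. -/
def ball (G : SimpleGraph V) (X : Set V) (r : ℕ) : Set V :=
  {u | ∃ v ∈ X, G.edist v u ≤ (r : ℕ∞)}

/-- `∂A`: the nodes in `A` which have a neighbour outside of `A`. -/
def boundary (G : SimpleGraph V) (A : Set V) : Set V :=
  {v | v ∈ A ∧ ∃ u, G.Adj v u ∧ u ∉ A}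

/-- The event "`τ` agrees with `s²` on `Y` and with `s³` on the boundary of `B`", for
configurations on a finite set `B`. -/
def boundaryEvent (G : SimpleGraph V) (B : Finset V) (Y : Set V) (s2 s3 : V → χ) :
    Set (B → χ) :=
  {τ | (∀ v : B, (v : V) ∈ Y → τ v = s2 v) ∧
    ∀ v : B, (v : V) ∈ boundary G (B : Set V) → τ v = s3 v}

/-- Strong spatial mixing (for a locally finite graph).  With the spins on the boundary of
`B = B_r(X)` fixed, the conditional law of the spins in `B` is the one of the finite
Gibbs measure on `B`, and only the part of `Y` inside `B` matters.  Only assignments for which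
the conditioning event has positive weight are compared. -/
def StrongSpatialMixing [Fintype χ] (G : SimpleGraph V) (M : Model χ) : Prop :=
  ∀ (X : Finset V) (Y : Set V), ∃ R : ℕ → ℝ, Tendsto R atTop (𝓝 0) ∧
    ∀ r : ℕ, 1 ≤ r → ∀ B : Finset V, (B : Set V) = ball G (X : Set V) r →
      ∀ s1 s2 s3 s4 : V → χ,
        weightOf G M B (boundaryEvent G B Y s2 s3) ≠ 0 →
        weightOf G M B (boundaryEvent G B Y s2 s4) ≠ 0 →
        |finCondProb G M B {τ | ∀ v : B, (v : V) ∈ X → τ v = s1 v} (boundaryEvent G B Y s2 s3)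
          - finCondProb G M B {τ | ∀ v : B, (v : V) ∈ X → τ v = s1 v}
              (boundaryEvent G B Y s2 s4)| ≤ R r

/-- In a graph with finite neighbourhoods all the balls `B_r(X)` around finite sets are finite. -/
theorem ball_finite (G : SimpleGraph V) (hG : ∀ v, (G.neighborSet v).Finite) {X : Set V}
    (hX : X.Finite) (r : ℕ) : (ball G X r).Finite := by
  induction r with
  | zero =>
    refine hX.subset ?_
    rintro u ⟨v, hv, h⟩
    have : v = u := by simpa using h
    exact this ▸ hv
  | succ r ih =>
    refine (ih.union (ih.biUnion fun v _ => hG v)).subset ?_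
    rintro u ⟨v, hv, h⟩
    have hne : G.edist v u ≠ ⊤ := fun h' => by
      rw [h'] at h
      exact absurd h (by simp)
    obtain ⟨p, hp⟩ := (SimpleGraph.edist_ne_top_iff_reachable.1 hne).exists_walk_length_eq_edist
    rw [← hp] at h
    have hl : p.length ≤ r + 1 := by exact_mod_cast h
    clear hp hne h
    rcases Nat.lt_or_ge r p.length with hlt | hle
    · right
      have hnn : ¬ p.reverse.Nil := by
        intro hn
        have := SimpleGraph.Walk.length_eq_zero_iff.2 hn
        rw [SimpleGraph.Walk.length_reverse] at this
        omega
      obtain ⟨w, hw, q, hq⟩ := SimpleGraph.Walk.not_nil_iff.1 hnn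
      have hql : q.length = r := by
        have := congrArg SimpleGraph.Walk.length hq
        rw [SimpleGraph.Walk.length_reverse, SimpleGraph.Walk.length_cons] at this
        omega
      refine Set.mem_biUnion (x := w) ⟨v, hv, ?_⟩ hw.symm
      rw [SimpleGraph.edist_comm, ← hql]
      exact q.edist_le
    · exact Or.inl ⟨v, hv, p.edist_le.trans (by exact_mod_cast hle)⟩

end Infinite

/-! ### The lattice and the edge model on it -/

/-- The `d`-dimensional lattice `ℤ ^ d`: `v` and `u` are adjacent iff `∑ |v_i - u_i| = 1`. -/
def lattice (d : ℕ) : SimpleGraph (Fin d → ℤ) where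
  Adj v u := ∑ i, |v i - u i| = 1
  symm := ⟨fun v u h => by simpa only [abs_sub_comm] using h⟩
  loopless := ⟨fun v h => by simp at h⟩

/-- The edges of `ℤ ^ d`: the sites of the edge model. -/
abbrev LatticeEdge (d : ℕ) : Type := (lattice d).edgeSet

/-- The graph of interactions of the edge model: two edges of `ℤ ^ d` interact iff they are
distinct and share a node. -/
abbrev edgeGraph (d : ℕ) : SimpleGraph (LatticeEdge d) := (lattice d).lineGraph

open Classical in
/-- `E(Λ)`: the edges of `ℤ ^ d` with both end points in the finite set `Λ` of nodes. -/
noncomputable def edgesIn (d : ℕ) (Λ : Finset (Fin d → ℤ)) : Finset (LatticeEdge d) :=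
  Λ.sym2.subtype (fun e => e ∈ (lattice d).edgeSet)

/-- `P` is the pressure (free energy per node) of the edge model: `log Z_Λ / |Λ|` tends to `P`,
where `Z_Λ` is the partition function of the edge model on the subgraph induced by `Λ`, along
every sequence of finite non-empty sets of nodes for which the proportion of boundary nodes tends
to zero. -/
def IsPressure {χ : Type*} [Fintype χ] (d : ℕ) (M : Model χ) (P : ℝ) : Prop :=
  ∀ Λ : ℕ → Finset (Fin d → ℤ), (∀ n, (Λ n).Nonempty) →
    Tendsto (fun n => ((boundary (lattice d) (Λ n : Set (Fin d → ℤ))).ncard : ℝ) / (Λ n).card)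
      atTop (𝓝 0) →
    Tendsto (fun n => Real.log (partitionFunction (edgeGraph d) M (edgesIn d (Λ n))) / (Λ n).card)
      atTop (𝓝 P)

/-- The lexicographic order `v ≺ u` on `ℤ ^ d`, the last coordinate being the most significant. -/
def LexLT {d : ℕ} (v u : Fin d → ℤ) : Prop :=
  ∃ k, v k < u k ∧ ∀ j, k < j → v j = u j

/-- The edges `(u, w)`, `w ∈ N(u)`, with `u ≻ 0`. -/
def laterEdges (d : ℕ) : Set (LatticeEdge d) :=
  {e | ∃ u ∈ (e : Sym2 (Fin d → ℤ)), LexLT 0 u}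

/-- The edges `(u, w)`, `w ∈ N(u)`, with `u ≻ 0` and `∑ u_i` even. -/
def laterEvenEdges (d : ℕ) : Set (LatticeEdge d) :=
  {e | ∃ u ∈ (e : Sym2 (Fin d → ℤ)), LexLT 0 u ∧ Even (∑ i, u i)}

/-- The event that all the edges at the origin have spin `s`. -/
def originEvent {χ : Type*} (d : ℕ) (s : χ) : Set (LatticeEdge d → χ) :=
  {ω | ∀ e : LatticeEdge d, (0 : Fin d → ℤ) ∈ (e : Sym2 (Fin d → ℤ)) → ω e = s}

end SpinSystem

/-! Write `Z_Λ` as the weight of the constant configuration `s*` divided by its probability under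
the finite Gibbs measure on `E(Λ)`. By the chain rule that probability is a product over the nodes
`v` of `Λ`, in lexicographic order: each factor is the conditional probability that the edges at `v`
have spin `s*`, given that the edges at later nodes do. Translating `v` to the origin turns the
factor into `originRatio` for `Λ - v`. If `v` is far from the boundary, strong spatial mixing makes
it close to a constant `p`; near the boundary its logarithm is still bounded, because `s*` is
compatible with every spin. Hence `log Z_Λ` is `-|Λ| log p` plus the logarithm of the constant
weight, up to `o(|Λ|)`. The latter counts `d` edges and `d(2d-1)` pairs of touching edges per node.
Since every edge has an even end point, revealing the even nodes alone also fixes every spin; they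
have density `1/2`, whence the second formula.

The link between finite systems and Gibbs measures is `IsLocallyGibbs.bounds`: a bound on
conditional probabilities in a ball, uniform in its boundary spins, survives averaging over those
spins, in any law with the right local specification. So `StrongSpatialMixing.exists_estimate`
compares finite weights and marginals of a Gibbs measure with the same numbers `q r`. This
identifies `p` with the infinite volume conditional probability and, when nothing is conditioned on,
gives uniqueness. Existence is compactness (`exists_isGibbsMeasure`). The asymptotics are assembled
in `hasDensity_log_partitionFunction`. -/

namespace SpinSystem

/-! ### Factorization of Gibbs weights and averaging over boundary spins -/

section Weights

variable {V χ : Type*}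

theorem expNeg_add (x y : WithTop ℝ) : expNeg (x + y) = expNeg x * expNeg y := by
  induction x with
  | top => simp [expNeg]
  | coe x =>
    induction y with
    | top => simp [expNeg]
    | coe y =>
      have : ((x : WithTop ℝ) + (y : WithTop ℝ)) = ((x + y : ℝ) : WithTop ℝ) := rfl
      rw [this]
      simp [expNeg, ← Real.exp_add]
      ring

theorem expNeg_nonneg (x : WithTop ℝ) : 0 ≤ expNeg x := by
  unfold expNeg
  split_ifs
  · exact le_rfl
  · exact (Real.exp_pos _).le

theorem expNeg_ne_zero {x : WithTop ℝ} : expNeg x ≠ 0 ↔ x ≠ ⊤ := by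
  unfold expNeg
  split_ifs with h <;> simp [h, Real.exp_ne_zero]

open Classical in
theorem energy_restrict (G : SimpleGraph V) (M : Model χ) (A : Finset V) (σ : V → χ) :
    energy G M A (fun v => σ v) =
      (∑ e ∈ A.sym2 with e ∈ G.edgeSet, M.pair (e.map σ))
        + ∑ v ∈ A, ((M.h (σ v) : ℝ) : WithTop ℝ) := by
  unfold energy
  congr 1
  · refine Finset.sum_bij (fun e _ => e.map Subtype.val) ?_ ?_ ?_ ?_
    · intro e he
      induction e with
      | _ u v => simpa using he
    · intro e _ f _ h
      exact Sym2.map.injective Subtype.val_injective h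
    · intro e he
      induction e with
      | _ u v =>
        simp only [Finset.mem_filter, Finset.mk_mem_sym2_iff, SimpleGraph.mem_edgeSet] at he
        exact ⟨s(⟨u, he.1.1⟩, ⟨v, he.1.2⟩), by simpa using he.2, by simp⟩
    · intro e _
      rw [Sym2.map_map]
      rfl
  · exact Finset.sum_coe_sort A (fun v => ((M.h (σ v) : ℝ) : WithTop ℝ))

theorem weight_nonneg (G : SimpleGraph V) (M : Model χ) (A : Finset V) (τ : A → χ) :
    0 ≤ weight G M A τ := expNeg_nonneg _

theorem weight_ne_zero_iff (G : SimpleGraph V) (M : Model χ) (A : Finset V) (σ : V → χ) :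
    weight G M A (fun v => σ v) ≠ 0 ↔
      ∀ u ∈ A, ∀ v ∈ A, G.Adj u v → M.H (σ u) (σ v) ≠ ⊤ := by
  classical
  unfold weight
  rw [expNeg_ne_zero, energy_restrict, WithTop.add_ne_top, WithTop.sum_ne_top, WithTop.sum_ne_top]
  constructor
  · intro h u hu v hv huv
    exact h.1 s(u, v) (by simp [hu, hv, huv])
  · intro h
    refine ⟨?_, fun v _ => WithTop.coe_ne_top⟩
    intro e he
    induction e with
    | _ u v =>
      simp only [Finset.mem_filter, Finset.mk_mem_sym2_iff, SimpleGraph.mem_edgeSet] at he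
      exact h u he.1.1 v he.1.2 he.2

/-- Lets configurations on different finite sets be compared as restrictions of one global
configuration. -/
theorem exists_extension (s : χ) (A : Finset V) (τ : A → χ) :
    ∃ σ : V → χ, τ = fun v : A => σ v := by
  classical
  exact ⟨fun v => if h : v ∈ A then τ ⟨v, h⟩ else s, by ext v; simp⟩

/-- The weight on `A` factorizes into the weight on a subset `B` which contains `C` and its
neighbours, and a factor that does not depend on the spins in `C`. -/
theorem exists_weight_eq_mul (G : SimpleGraph V) (M : Model χ) {A B C : Finset V} (hBA : B ⊆ A)
    (hCB : C ⊆ B) (hC : ∀ v ∈ C, ∀ u ∈ A, G.Adj v u → u ∈ B) (η : V → χ) :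
    ∃ ρ : ℝ, 0 ≤ ρ ∧ ∀ σ : V → χ, (∀ v ∈ A, v ∉ C → σ v = η v) →
      weight G M A (fun v => σ v) = ρ * weight G M B (fun v => σ v) := by
  classical
  refine ⟨expNeg ((∑ e ∈ (A.sym2.filter (· ∈ G.edgeSet)) \ (B.sym2.filter (· ∈ G.edgeSet)),
    M.pair (e.map η)) + ∑ v ∈ A \ B, ((M.h (η v) : ℝ) : WithTop ℝ)), expNeg_nonneg _, ?_⟩
  intro σ hσ
  unfold weight
  rw [← expNeg_add, energy_restrict, energy_restrict]
  have hsub : B.sym2.filter (· ∈ G.edgeSet) ⊆ A.sym2.filter (· ∈ G.edgeSet) :=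
    Finset.filter_subset_filter _ (Finset.sym2_mono hBA)
  rw [← Finset.sum_sdiff hsub, ← Finset.sum_sdiff hBA]
  congr 1
  have h1 : ∑ e ∈ (A.sym2.filter (· ∈ G.edgeSet)) \ (B.sym2.filter (· ∈ G.edgeSet)),
      M.pair (e.map η) = ∑ e ∈ (A.sym2.filter (· ∈ G.edgeSet)) \ (B.sym2.filter (· ∈ G.edgeSet)),
      M.pair (e.map σ) := by
    refine Finset.sum_congr rfl fun e he => ?_
    induction e with
    | _ u v =>
      simp only [Finset.mem_sdiff, Finset.mem_filter, Finset.mk_mem_sym2_iff,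
        SimpleGraph.mem_edgeSet, not_and] at he
      obtain ⟨⟨⟨hu, hv⟩, huv⟩, h⟩ := he
      have hu' : u ∉ C := fun h' => h ⟨hCB h', hC u h' v hv huv⟩ huv
      have hv' : v ∉ C := fun h' => h ⟨hC v h' u hu huv.symm, hCB h'⟩ huv
      simp [hσ u hu hu', hσ v hv hv']
  have h2 : ∑ v ∈ A \ B, ((M.h (η v) : ℝ) : WithTop ℝ)
      = ∑ v ∈ A \ B, ((M.h (σ v) : ℝ) : WithTop ℝ) := by
    refine Finset.sum_congr rfl fun v hv => ?_
    rw [Finset.mem_sdiff] at hv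
    rw [hσ v hv.1 fun h => hv.2 (hCB h)]
  rw [h1, h2]
  abel

/-- The configurations on `A` which agree with `σ` on `F`. -/
def cyl (A : Finset V) (F : Set V) (σ : V → χ) : Set (A → χ) :=
  {τ | ∀ v : A, (v : V) ∈ F → τ v = σ v}

theorem cyl_inter_cyl (A : Finset V) (F F' : Set V) (σ : V → χ) :
    cyl A F σ ∩ cyl A F' σ = cyl A (F ∪ F') σ := by
  ext τ
  simp only [cyl, Set.mem_inter_iff, Set.mem_ofPred_eq, Set.mem_union]
  exact ⟨fun h v hv => hv.elim (h.1 v) (h.2 v), fun h => ⟨fun v hv => h v (.inl hv),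
    fun v hv => h v (.inr hv)⟩⟩

theorem cyl_congr {A : Finset V} {F F' : Set V} (h : ∀ v ∈ A, v ∈ F ↔ v ∈ F') (σ : V → χ) :
    cyl A F σ = cyl A F' σ := by
  ext τ
  exact forall_congr' fun v => by rw [h v v.2]

/-- Given the spins in `A \ C`, the law of the spins in `C` under the (unnormalized) law `m` on
`χ ^ A` is the one given by the Gibbs weights. -/
def IsLocallyGibbs (G : SimpleGraph V) (M : Model χ) (A C : Finset V) (m : (A → χ) → ℝ) : Prop :=
  ∀ η : V → χ, ∃ k : ℝ, 0 ≤ k ∧ ∀ σ : V → χ, (∀ v ∈ A, v ∉ C → σ v = η v) →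
    m (fun v => σ v) = k * weight G M A (fun v => σ v)

theorem isLocallyGibbs_weight (G : SimpleGraph V) (M : Model χ) (A C : Finset V) :
    IsLocallyGibbs G M A C (weight G M A) :=
  fun _ => ⟨1, zero_le_one, fun _ _ => (one_mul _).symm⟩

variable [Fintype χ]

open Classical in
/-- The total mass under `m` of a set of configurations. -/
noncomputable def mass {A : Finset V} (m : (A → χ) → ℝ) (S : Set (A → χ)) : ℝ :=
  ∑ τ : A → χ with τ ∈ S, m τ

theorem weightOf_eq_mass (G : SimpleGraph V) (M : Model χ) (A : Finset V) (S : Set (A → χ)) :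
    weightOf G M A S = mass (weight G M A) S := rfl

theorem mass_nonneg {A : Finset V} {m : (A → χ) → ℝ} (hm : ∀ τ, 0 ≤ m τ) (S : Set (A → χ)) :
    0 ≤ mass m S := Finset.sum_nonneg fun τ _ => hm τ

theorem mass_mono {A : Finset V} {m : (A → χ) → ℝ} (hm : ∀ τ, 0 ≤ m τ) {S T : Set (A → χ)}
    (h : S ⊆ T) : mass m S ≤ mass m T := by
  classical
  refine Finset.sum_le_sum_of_subset_of_nonneg ?_ fun τ _ _ => hm τ
  intro τ hτ
  simp only [Finset.mem_filter, Finset.mem_univ, true_and] at hτ ⊢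
  exact h hτ

theorem mass_pos {A : Finset V} {m : (A → χ) → ℝ} (hm : ∀ τ, 0 ≤ m τ) {S : Set (A → χ)}
    {τ : A → χ} (hτ : τ ∈ S) (h : m τ ≠ 0) : 0 < mass m S := by
  classical
  exact Finset.sum_pos' (fun τ _ => hm τ) ⟨τ, by simpa using hτ, (hm τ).lt_of_ne' h⟩

theorem weightOf_singleton (G : SimpleGraph V) (M : Model χ) (A : Finset V) (τ : A → χ) :
    weightOf G M A {τ} = weight G M A τ := by
  classical
  unfold weightOf
  rw [Finset.sum_eq_single_of_mem τ (by simp)]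
  intro τ' hτ' hne
  exact absurd (by simpa using hτ') hne

theorem exists_of_mass_ne_zero {A : Finset V} {m : (A → χ) → ℝ} {S : Set (A → χ)}
    (h : mass m S ≠ 0) : ∃ τ ∈ S, m τ ≠ 0 := by
  classical
  obtain ⟨τ, hτ, h'⟩ := Finset.exists_ne_zero_of_sum_ne_zero h
  exact ⟨τ, by simpa using hτ, h'⟩

/-- Sums over a fibre of the restriction to `A \ C` can be computed in a subset `B ⊇ C`. -/
theorem mass_fibre {A B C : Finset V} (hBA : B ⊆ A) (hCB : C ⊆ B) (f : (B → χ) → ℝ)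
    (P : Set (B → χ)) (η : V → χ) :
    mass (fun τ : A → χ => f fun v => τ ⟨v, hBA v.2⟩)
        ({τ | (fun v : B => τ ⟨v, hBA v.2⟩) ∈ P} ∩ cyl A (C : Set V)ᶜ η) =
      mass f (P ∩ cyl B (C : Set V)ᶜ η) := by
  classical
  unfold mass
  refine Finset.sum_bij' (fun τ _ => fun v => τ ⟨v, hBA v.2⟩)
    (fun τ _ => fun v => if h : (v : V) ∈ B then τ ⟨v, h⟩ else η v) ?_ ?_ ?_ ?_ ?_
  · intro τ hτ
    simp only [Finset.mem_filter, Finset.mem_univ, true_and, Set.mem_inter_iff] at hτ ⊢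
    exact ⟨hτ.1, fun v hv => hτ.2 ⟨v, hBA v.2⟩ hv⟩
  · intro τ hτ
    simp only [Finset.mem_filter, Finset.mem_univ, true_and, Set.mem_inter_iff] at hτ ⊢
    refine ⟨?_, fun v hv => ?_⟩
    · simpa using hτ.1
    · by_cases h : (v : V) ∈ B
      · simpa [h] using hτ.2 ⟨v, h⟩ hv
      · simp [h]
  · intro τ hτ
    simp only [Finset.mem_filter, Finset.mem_univ, true_and, Set.mem_inter_iff] at hτ
    ext v
    by_cases h : (v : V) ∈ B
    · simp [h]
    · simp only [h, dite_false]
      exact (hτ.2 v fun h' => h (hCB h')).symm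
  · intro τ _
    ext v
    simp
  · intro τ _
    rfl

/-- Bounds for the conditional probabilities in the subsystem `B`, uniform in the spins
in `B \ C`, carry over to every larger system. -/
theorem IsLocallyGibbs.bounds {G : SimpleGraph V} {M : Model χ} {A B C : Finset V}
    (s : χ) (hBA : B ⊆ A) (hCB : C ⊆ B) (hC : ∀ v ∈ C, ∀ u ∈ A, G.Adj v u → u ∈ B)
    {m : (A → χ) → ℝ} (hm : IsLocallyGibbs G M A C m) (X F : Set V)
    (hX : ∀ v ∈ A, v ∈ X → v ∈ B) (s1 s2 : V → χ) {a b : ℝ}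
    (hab : ∀ s3 : V → χ,
      weightOf G M B (cyl B F s2 ∩ cyl B (C : Set V)ᶜ s3) ≠ 0 →
      a ≤ finCondProb G M B (cyl B X s1) (cyl B F s2 ∩ cyl B (C : Set V)ᶜ s3) ∧
      finCondProb G M B (cyl B X s1) (cyl B F s2 ∩ cyl B (C : Set V)ᶜ s3) ≤ b) :
    a * mass m (cyl A F s2) ≤ mass m (cyl A X s1 ∩ cyl A F s2) ∧
      mass m (cyl A X s1 ∩ cyl A F s2) ≤ b * mass m (cyl A F s2) := by
  classical
  -- Erasing the spins in `C` sorts configurations by their values off `C`; the filler `s` is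
  -- arbitrary. The inequalities are proved on each fibre of `g` and summed.
  let g : (A → χ) → (A → χ) := fun τ v => if (v : V) ∈ C then s else τ v
  have hdec : ∀ S : Set (A → χ), mass m S = ∑ j : A → χ, mass m (S ∩ {τ | g τ = j}) := by
    intro S
    unfold mass
    rw [← Finset.sum_fiberwise _ g]
    refine Finset.sum_congr rfl fun j _ => ?_
    rw [Finset.filter_filter]
    exact Finset.sum_congr (by ext τ; simp) fun _ _ => rfl
  rw [hdec (cyl A F s2), hdec (cyl A X s1 ∩ cyl A F s2), Finset.mul_sum, Finset.mul_sum]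
  have key : ∀ j : A → χ, a * mass m (cyl A F s2 ∩ {τ | g τ = j}) ≤
      mass m (cyl A X s1 ∩ cyl A F s2 ∩ {τ | g τ = j}) ∧
      mass m (cyl A X s1 ∩ cyl A F s2 ∩ {τ | g τ = j}) ≤
      b * mass m (cyl A F s2 ∩ {τ | g τ = j}) := by
    intro j
    by_cases hj : ∃ τ₀ ∈ cyl A F s2, g τ₀ = j
    swap
    · have h0 : cyl A F s2 ∩ {τ | g τ = j} = ∅ := by
        ext τ
        simp only [Set.mem_inter_iff, Set.mem_ofPred_eq, Set.mem_empty_iff_false, iff_false]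
        exact fun h => hj ⟨τ, h.1, h.2⟩
      rw [Set.inter_assoc, h0]
      simp [mass]
    obtain ⟨τ₀, hτ₀, rfl⟩ := hj
    obtain ⟨η, rfl⟩ := exists_extension s A τ₀
    have hfib : {τ | g τ = g fun v => η v} = cyl A (C : Set V)ᶜ η := by
      ext τ
      simp only [Set.mem_ofPred_eq, cyl, g, funext_iff, Set.mem_compl_iff, Finset.mem_coe]
      refine forall_congr' fun v => ?_
      by_cases hv : (v : V) ∈ C <;> simp [hv]
    rw [hfib]
    obtain ⟨k, hk, hmk⟩ := hm η
    obtain ⟨ρ, hρ, hwρ⟩ := exists_weight_eq_mul G M hBA hCB hC η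
    -- On one fibre `m` is a constant multiple of the weight on `A`, which is a constant multiple of
    -- the weight on `B`; so masses on the fibre are computed in `B`.
    have hmass : ∀ (S : Set (A → χ)) (P : Set (B → χ)),
        (∀ τ ∈ cyl A (C : Set V)ᶜ η, τ ∈ S ↔ (fun v : B => τ ⟨v, hBA v.2⟩) ∈ P) →
        mass m (S ∩ cyl A (C : Set V)ᶜ η) =
          k * ρ * weightOf G M B (P ∩ cyl B (C : Set V)ᶜ η) := by
      intro S P hSP
      rw [weightOf_eq_mass, ← mass_fibre hBA hCB, mass, mass, Finset.mul_sum]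
      refine Finset.sum_congr ?_ ?_
      · ext τ
        simp only [Finset.mem_filter, Finset.mem_univ, true_and, Set.mem_inter_iff]
        exact and_congr_left fun h => hSP τ h
      · intro τ hτ
        simp only [Finset.mem_filter, Finset.mem_univ, true_and, Set.mem_inter_iff] at hτ
        obtain ⟨σ, rfl⟩ := exists_extension s A τ
        have h := fun v (hv : v ∈ A) (hv' : v ∉ C) => hτ.2 ⟨v, hv⟩ hv'
        rw [hmk σ h, hwρ σ h, mul_assoc]
    have hF : ∀ τ ∈ cyl A (C : Set V)ᶜ η,
        τ ∈ cyl A F s2 ↔ (fun v : B => τ ⟨v, hBA v.2⟩) ∈ cyl B F s2 := by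
      intro τ hτ
      refine ⟨fun h v hv => h ⟨v, hBA v.2⟩ hv, fun h v hv => ?_⟩
      by_cases hvB : (v : V) ∈ B
      · exact h ⟨v, hvB⟩ hv
      -- Outside `B` the fibre is frozen at a configuration that already satisfies the condition on
      -- `F`.
      · rw [hτ v fun h' => hvB (hCB h')]
        exact hτ₀ v hv
    have hXF : ∀ τ ∈ cyl A (C : Set V)ᶜ η, τ ∈ cyl A X s1 ∩ cyl A F s2 ↔
        (fun v : B => τ ⟨v, hBA v.2⟩) ∈ cyl B X s1 ∩ cyl B F s2 := by
      intro τ hτ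
      refine and_congr ⟨fun h v hv => h ⟨v, hBA v.2⟩ hv, fun h v hv => ?_⟩ (hF τ hτ)
      exact h ⟨v, hX v v.2 hv⟩ hv
    rw [hmass _ _ hF, hmass _ _ hXF]
    have hkρ : 0 ≤ k * ρ := mul_nonneg hk hρ
    -- The hypothesis says nothing about infeasible boundary spins, but these contribute zero to
    -- every term.
    by_cases h0 : weightOf G M B (cyl B F s2 ∩ cyl B (C : Set V)ᶜ η) = 0
    · have h1 : weightOf G M B (cyl B X s1 ∩ cyl B F s2 ∩ cyl B (C : Set V)ᶜ η) = 0 := by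
        rw [weightOf_eq_mass] at h0 ⊢
        refine le_antisymm ?_ (mass_nonneg (weight_nonneg G M B) _)
        rw [← h0, Set.inter_assoc]
        exact mass_mono (weight_nonneg G M B) Set.inter_subset_right
      rw [h0, h1]
      simp
    · have hpos : 0 < weightOf G M B (cyl B F s2 ∩ cyl B (C : Set V)ᶜ η) :=
        lt_of_le_of_ne' (mass_nonneg (weight_nonneg G M B) _) h0
      obtain ⟨h1, h2⟩ := hab η h0
      rw [finCondProb, ← Set.inter_assoc] at h1 h2
      rw [le_div_iff₀ hpos] at h1
      rw [div_le_iff₀ hpos] at h2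
      constructor
      · calc _ = k * ρ * (a * weightOf G M B (cyl B F s2 ∩ cyl B (C : Set V)ᶜ η)) := by ring
          _ ≤ _ := mul_le_mul_of_nonneg_left h1 hkρ
      · calc _ ≤ k * ρ * (b * weightOf G M B (cyl B F s2 ∩ cyl B (C : Set V)ᶜ η)) :=
              mul_le_mul_of_nonneg_left h2 hkρ
          _ = _ := by ring
  exact ⟨Finset.sum_le_sum fun j _ => (key j).1, Finset.sum_le_sum fun j _ => (key j).2⟩

end Weights

/-! ### Consequences of strong spatial mixing and of the compatible spin -/

section Mixing

variable {V χ : Type*} {G : SimpleGraph V} {M : Model χ}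

theorem IsLocallyGibbs.mono {A C C' : Finset V} {m : (A → χ) → ℝ}
    (hm : IsLocallyGibbs G M A C m) (h : C' ⊆ C) : IsLocallyGibbs G M A C' m := by
  intro η
  obtain ⟨k, hk, hk'⟩ := hm η
  exact ⟨k, hk, fun σ hσ => hk' σ fun v hv hvC => hσ v hv fun h' => hvC (h h')⟩

theorem weight_const_ne_zero (G : SimpleGraph V) {s : χ} (hs : ∀ t, M.H t s ≠ ⊤) (A : Finset V) :
    weight G M A (fun _ => s) ≠ 0 :=
  (weight_ne_zero_iff G M A fun _ => s).2 fun _ _ _ _ _ => hs s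

/-- Resetting spins to `s` cannot create a forbidden pair, as `s` is compatible with every spin. -/
theorem exists_weight_ne_zero_of_eq_on {s : χ} (hs : ∀ t, M.H t s ≠ ⊤) (X : Finset V)
    {B : Finset V} {σ : V → χ} (hσ : weight G M B (fun v => σ v) ≠ 0) :
    ∃ σ' : V → χ, weight G M B (fun v => σ' v) ≠ 0 ∧ (∀ v ∈ X, σ' v = s) ∧
      ∀ v ∉ X, σ' v = σ v := by
  classical
  refine ⟨fun v => if v ∈ X then s else σ v, ?_, fun v hv => if_pos hv, fun v hv => if_neg hv⟩
  rw [weight_ne_zero_iff] at hσ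
  refine (weight_ne_zero_iff G M B fun v => if v ∈ X then s else σ v).2 ?_
  intro u hu v hv huv
  by_cases h : v ∈ X
  · rw [if_pos h]
    exact hs _
  · by_cases h' : u ∈ X
    · rw [M.symm, if_pos h']
      exact hs _
    · rw [if_neg h, if_neg h']
      exact hσ u hu v hv huv

variable [Fintype χ]

theorem weightOf_cyl_const_pos (G : SimpleGraph V) {s : χ} (hs : ∀ t, M.H t s ≠ ⊤) (A : Finset V)
    (F : Set V) : 0 < weightOf G M A (cyl A F fun _ => s) := by
  have h : (fun _ => s) ∈ cyl A F fun _ => s := fun _ _ => rfl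
  exact mass_pos (weight_nonneg G M A) h (weight_const_ne_zero G hs A)

/-- Under strong spatial mixing, the conditional probability of `s1` on `X`, given that the spins
in `F` are equal to `s`, is determined by `F` in a large ball around `X`, up to a small error. -/
theorem StrongSpatialMixing.exists_estimate (hSSM : StrongSpatialMixing G M)
    (hG : ∀ v, (G.neighborSet v).Finite) {s : χ} (hs : ∀ t, M.H t s ≠ ⊤) (X : Finset V)
    (Y : Set V) (s1 : V → χ) :
    ∃ R q : ℕ → ℝ, Tendsto R atTop (𝓝 0) ∧ ∀ r, 1 ≤ r → ∃ B C : Finset V, C ⊆ B ∧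
      (∀ v ∈ C, ∀ u, G.Adj v u → u ∈ B) ∧ ∀ A : Finset V, B ⊆ A → ∀ m : (A → χ) → ℝ,
        IsLocallyGibbs G M A C m → ∀ F : Set V, (∀ v ∈ B, v ∈ F ↔ v ∈ Y) →
        |mass m (cyl A X s1 ∩ cyl A F fun _ => s) - q r * mass m (cyl A F fun _ => s)| ≤
          R r * mass m (cyl A F fun _ => s) := by
  classical
  obtain ⟨R, hR, hmix⟩ := hSSM X Y
  have hfin : ∀ r, (ball G (X : Set V) r).Finite := ball_finite G hG X.finite_toSet
  let B : ℕ → Finset V := fun r => (hfin r).toFinset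
  have hB : ∀ r, (B r : Set V) = ball G X r := fun r => (hfin r).coe_toFinset
  -- The reference value `q r` takes boundary spins `s`, which are always feasible. Mixing bounds
  -- the distance from it to the value for any other feasible boundary spins.
  refine ⟨R, fun r => finCondProb G M (B r) (cyl (B r) X s1)
    (boundaryEvent G (B r) Y (fun _ => s) fun _ => s), hR, fun r hr => ?_⟩
  -- `C` is the ball without its boundary: its neighbours stay in the ball, and fixing the spins off
  -- `C` means fixing those on the boundary.
  refine ⟨B r, (B r).filter (· ∉ boundary G (B r : Set V)), Finset.filter_subset _ _, ?_, ?_⟩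
  · intro v hv u hvu
    rw [Finset.mem_filter] at hv
    by_contra hu
    exact hv.2 ⟨hv.1, u, hvu, hu⟩
  intro A hBA m hm F hF
  have hevent : ∀ s3 : V → χ, cyl (B r) F (fun _ => s) ∩
      cyl (B r) ((((B r).filter (· ∉ boundary G (B r : Set V)) : Finset V) : Set V)ᶜ) s3 =
      boundaryEvent G (B r) Y (fun _ => s) s3 := by
    intro s3
    have h : ∀ v ∈ B r, v ∈ ((((B r).filter (· ∉ boundary G (B r : Set V)) : Finset V) :
        Set V)ᶜ) ↔ v ∈ boundary G (B r : Set V) := by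
      intro v hv
      simp only [Finset.coe_filter, Set.mem_compl_iff, Set.mem_ofPred_eq, hv, true_and, not_not]
    rw [cyl_congr hF, cyl_congr h]
    rfl
  have hXB : ∀ v ∈ A, v ∈ (X : Set V) → v ∈ B r := by
    intro v _ hv
    rw [← Finset.mem_coe, hB]
    exact ⟨v, hv, by simp⟩
  have hne : weightOf G M (B r) (boundaryEvent G (B r) Y (fun _ => s) fun _ => s) ≠ 0 := by
    have hmem : (fun _ => s) ∈ boundaryEvent G (B r) Y (fun _ => s) fun _ => s :=
      ⟨fun _ _ => rfl, fun _ _ => rfl⟩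
    exact (mass_pos (weight_nonneg G M _) hmem (weight_const_ne_zero G hs _)).ne'
  have h := hm.bounds s hBA (Finset.filter_subset _ _) ?_ X F hXB s1 (fun _ => s)
    (a := finCondProb G M (B r) (cyl (B r) X s1)
      (boundaryEvent G (B r) Y (fun _ => s) fun _ => s) - R r)
    (b := finCondProb G M (B r) (cyl (B r) X s1)
      (boundaryEvent G (B r) Y (fun _ => s) fun _ => s) + R r) ?_
  · rw [abs_le]
    constructor <;> nlinarith [h.1, h.2]
  · intro v hv u _ hvu
    rw [Finset.mem_filter] at hv
    by_contra hu
    exact hv.2 ⟨hv.1, u, hvu, hu⟩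
  · intro s3 h3
    rw [hevent] at h3 ⊢
    have := abs_le.1 (hmix r hr (B r) (hB r) s1 (fun _ => s) s3 (fun _ => s) h3 hne)
    change -R r ≤ finCondProb G M (B r) (cyl (B r) X s1) _
      - finCondProb G M (B r) (cyl (B r) X s1) _ ∧ _ at this
    constructor
    · linarith [this.1]
    · have h2 : finCondProb G M (B r) (cyl (B r) X s1) _
        - finCondProb G M (B r) (cyl (B r) X s1) _ ≤ R r := this.2
      linarith

/-- A finite system has only finitely many pairs of events, so the positive conditional
probabilities have a positive minimum. -/
theorem exists_pos_le_finCondProb (G : SimpleGraph V) (M : Model χ) (B : Finset V) :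
    ∃ c : ℝ, 0 < c ∧ ∀ S T : Set (B → χ), 0 < weightOf G M B (S ∩ T) →
      c ≤ finCondProb G M B S T := by
  classical
  let f : Set (B → χ) × Set (B → χ) → ℝ := fun p =>
    if 0 < weightOf G M B (p.1 ∩ p.2) then finCondProb G M B p.1 p.2 else 1
  have hf : ∀ p, 0 < f p := by
    intro p
    simp only [f]
    split_ifs with h
    · exact div_pos h (h.trans_le (mass_mono (weight_nonneg G M B) Set.inter_subset_right))
    · exact one_pos
  obtain ⟨p, hp⟩ := Finite.exists_min f
  exact ⟨f p, hf p, fun S T h => (hp (S, T)).trans_eq (by simp [f, h])⟩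

/-- The spins in `X` are equal to `s` with a conditional probability that is bounded below by a
constant which only depends on `X`. -/
theorem exists_pos_le_mass (hG : ∀ v, (G.neighborSet v).Finite) {s : χ} (hs : ∀ t, M.H t s ≠ ⊤)
    (X : Finset V) :
    ∃ c : ℝ, 0 < c ∧ ∀ (A : Finset V) (m : (A → χ) → ℝ), IsLocallyGibbs G M A X m →
      ∀ F : Set V, c * mass m (cyl A F fun _ => s) ≤
        mass m (cyl A X (fun _ => s) ∩ cyl A F fun _ => s) := by
  classical
  let N : Finset V := X ∪ X.biUnion fun v => (hG v).toFinset
  choose c hc0 hc using exists_pos_le_finCondProb (χ := χ) G M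
  -- `A` may cut the neighbourhood `N` of `X`, so the relevant subsystem is `N ∩ A`. Minimizing over
  -- all subsets of `N` makes the constant independent of `A`.
  obtain ⟨B₀, _, hB₀⟩ := Finset.exists_min_image N.powerset c ⟨N, Finset.mem_powerset_self N⟩
  refine ⟨c B₀, hc0 B₀, fun A m hm F => ?_⟩
  have hNA : N ∩ A ∈ N.powerset := Finset.mem_powerset.2 Finset.inter_subset_left
  refine (hm.mono (C' := X ∩ A) Finset.inter_subset_left |>.bounds s (B := N ∩ A) (b := 1)
    Finset.inter_subset_right (Finset.inter_subset_inter_right Finset.subset_union_left) ?_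
    X F ?_ _ _ ?_).1
  · intro v hv u hu hvu
    simp only [Finset.mem_inter, N, Finset.mem_union, Finset.mem_biUnion, Set.Finite.mem_toFinset]
      at hv ⊢
    exact ⟨.inr ⟨v, hv.1, hvu⟩, hu⟩
  · intro v hv hvX
    exact Finset.mem_inter.2 ⟨Finset.mem_union_left _ hvX, hv⟩
  · intro s3 h3
    set T := cyl (N ∩ A) F (fun _ => s) ∩ cyl (N ∩ A) ((X ∩ A : Finset V) : Set V)ᶜ s3 with hT
    have hle : weightOf G M (N ∩ A) (cyl (N ∩ A) X (fun _ => s) ∩ T) ≤ weightOf G M (N ∩ A) T :=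
      mass_mono (weight_nonneg G M _) Set.inter_subset_right
    constructor
    · refine (hB₀ _ hNA).trans (hc _ _ _ ?_)
      obtain ⟨τ, hτT, hτ⟩ := exists_of_mass_ne_zero h3
      obtain ⟨σ, rfl⟩ := exists_extension s _ τ
      -- The modified configuration still meets the condition on `F`, because that condition also
      -- prescribes the spin `s`.
      obtain ⟨σ', hσ', hX, hX'⟩ := exists_weight_ne_zero_of_eq_on hs X hτ
      have hmem : (fun v : (N ∩ A : Finset V) => σ' v) ∈ cyl (N ∩ A) X (fun _ => s) ∩ T := by
        refine ⟨fun v hv => hX v hv, fun v hv => ?_, fun v hv => ?_⟩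
        · by_cases h : (v : V) ∈ X
          · exact hX v h
          · exact (hX' v h).trans (hτT.1 v hv)
        · have h : (v : V) ∉ X := fun h => hv (Finset.mem_coe.2 (Finset.mem_inter.2
            ⟨h, (Finset.mem_inter.1 v.2).2⟩))
          exact (hX' v h).trans (hτT.2 v hv)
      exact mass_pos (weight_nonneg G M _) hmem hσ'
    · exact div_le_one_of_le₀ hle (mass_nonneg (weight_nonneg G M _) _)

end Mixing

/-- A function that is eventually within `R r` of `q r`, for every `r`, converges if `R r → 0`. -/
theorem exists_tendsto_of_eventually_abs_sub_le {ι : Type*} {l : Filter ι} [l.NeBot] {x : ι → ℝ}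
    {q R : ℕ → ℝ} (hR : Tendsto R atTop (𝓝 0))
    (h : ∀ r, 1 ≤ r → ∀ᶠ i in l, |x i - q r| ≤ R r) :
    ∃ p, Tendsto x l (𝓝 p) ∧ ∀ r, 1 ≤ r → |p - q r| ≤ R r := by
  have hc : Cauchy (map x l) := by
    rw [Metric.cauchy_iff]
    refine ⟨inferInstance, fun ε hε => ?_⟩
    obtain ⟨r, hr1, hr⟩ :=
      ((eventually_ge_atTop 1).and (hR.eventually (gt_mem_nhds (half_pos hε)))).exists
    refine ⟨x '' {i | |x i - q r| ≤ R r}, image_mem_map (h r hr1), ?_⟩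
    rintro _ ⟨i, hi, rfl⟩ _ ⟨j, hj, rfl⟩
    rw [Real.dist_eq]
    have hi' : |x i - q r| ≤ R r := hi
    have hj' : |x j - q r| ≤ R r := hj
    rw [abs_le] at hi' hj'
    rw [abs_lt]
    constructor <;> linarith [hi'.1, hi'.2, hj'.1, hj'.2]
  obtain ⟨p, hp⟩ := CompleteSpace.complete hc
  refine ⟨p, hp, fun r hr => ?_⟩
  have ht : Tendsto (fun i => |x i - q r|) l (𝓝 |p - q r|) :=
    (Tendsto.sub_const (show Tendsto x l (𝓝 p) from hp) _).abs
  exact le_of_tendsto ht (h r hr)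

/-! ### Conditional probabilities under Gibbs measures, and uniqueness -/

section GibbsMeasures

variable {V χ : Type*} {G : SimpleGraph V} {M : Model χ}

/-- The probabilities, under `μ`, of the configurations on the finite set `A`. -/
noncomputable def marginal [MeasurableSpace χ] (μ : Measure (V → χ)) (A : Finset V)
    (τ : A → χ) : ℝ :=
  μ.real {ω | ∀ v : A, ω v = τ v}

theorem marginal_restrict [MeasurableSpace χ] (μ : Measure (V → χ)) (A : Finset V) (σ : V → χ) :
    marginal μ A (fun v => σ v) = μ.real {ω | ∀ v ∈ A, ω v = σ v} := by
  unfold marginal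
  congr 1
  ext ω
  simp

theorem measurable_restrict_coe [MeasurableSpace χ] (A : Finset V) :
    Measurable (fun (ω : V → χ) (v : A) => ω v) :=
  measurable_pi_lambda _ fun v => measurable_pi_apply (v : V)

theorem setOf_forall_mem_union [DecidableEq V] (X F : Finset V) (s : χ) :
    {ω : V → χ | ∀ v ∈ X ∪ F, ω v = s} = {ω | (∀ v ∈ X, ω v = s) ∧ ∀ v ∈ F, ω v = s} := by
  ext ω
  simp only [Set.mem_ofPred_eq, Finset.mem_union]
  exact ⟨fun h => ⟨fun v hv => h v (.inl hv), fun v hv => h v (.inr hv)⟩,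
    fun h v hv => hv.elim (h.1 v) (h.2 v)⟩

variable [Fintype χ] [MeasurableSpace χ] [DiscreteMeasurableSpace χ]

theorem mass_marginal (μ : Measure (V → χ)) [IsFiniteMeasure μ] (A : Finset V)
    (S : Set (A → χ)) : mass (marginal μ A) S = μ.real {ω | (fun v : A => ω v) ∈ S} := by
  classical
  have h : ∀ τ : A → χ, marginal μ A τ = (μ.map fun (ω : V → χ) (v : A) => ω v).real {τ} := by
    intro τ
    rw [map_measureReal_apply (measurable_restrict_coe A) (measurableSet_singleton τ), marginal]
    congr 1
    ext ω
    simp [funext_iff]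
  unfold mass
  simp_rw [h]
  rw [sum_measureReal_singleton,
    map_measureReal_apply (measurable_restrict_coe A) (Finset.measurableSet _)]
  congr 1
  ext ω
  simp

theorem mass_marginal_cyl (μ : Measure (V → χ)) [IsFiniteMeasure μ] (A : Finset V) (F : Set V)
    (σ : V → χ) :
    mass (marginal μ A) (cyl A F σ) = μ.real {ω | ∀ v ∈ A, v ∈ F → ω v = σ v} := by
  rw [mass_marginal]
  congr 1
  ext ω
  simp [cyl]

omit [DiscreteMeasurableSpace χ] in
theorem IsGibbsMeasure.isLocallyGibbs {μ : Measure (V → χ)} (hμ : IsGibbsMeasure G M μ)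
    {A C : Finset V} (hCA : C ⊆ A) (hC : ∀ v ∈ C, ∀ u, G.Adj v u → u ∈ A) :
    IsLocallyGibbs G M A C (marginal μ A) := by
  classical
  intro η
  -- If the denominator vanishes, so does `finCondProb`, and both sides of the identity are zero.
  refine ⟨μ.real {ω | ∀ v ∈ A, v ∉ C → ω v = η v} /
    weightOf G M A {τ | ∀ v : A, (v : V) ∉ C → τ v = η v},
    div_nonneg measureReal_nonneg (mass_nonneg (weight_nonneg G M A) _), fun σ hσ => ?_⟩
  rw [marginal_restrict, hμ.dlr C A hCA hC σ]
  have h1 : {ω : V → χ | ∀ v ∈ A, v ∉ C → ω v = σ v} = {ω | ∀ v ∈ A, v ∉ C → ω v = η v} := by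
    ext ω
    exact forall_congr' fun v => forall_congr' fun hv => forall_congr' fun hvC => by
      rw [hσ v hv hvC]
  have h2 : {τ : A → χ | ∀ v : A, (v : V) ∉ C → τ v = σ v} =
      {τ | ∀ v : A, (v : V) ∉ C → τ v = η v} := by
    ext τ
    exact forall_congr' fun v => forall_congr' fun hvC => by rw [hσ v v.2 hvC]
  have h3 : {τ : A → χ | ∀ v : A, (v : V) ∈ C → τ v = σ v} ∩
      {τ | ∀ v : A, (v : V) ∉ C → τ v = σ v} = {fun v : A => σ v} := by
    ext τ
    simp only [Set.mem_inter_iff, Set.mem_ofPred_eq, Set.mem_singleton_iff, funext_iff]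
    refine ⟨fun h v => ?_, fun h => ⟨fun v _ => h v, fun v _ => h v⟩⟩
    by_cases hv : (v : V) ∈ C
    · exact h.1 v hv
    · exact h.2 v hv
  rw [finCondProb, h3, weightOf_singleton, h1, h2]
  ring

theorem mass_marginal_cyl_coe (μ : Measure (V → χ)) [IsFiniteMeasure μ] {A F : Finset V}
    (hF : F ⊆ A) (σ : V → χ) :
    mass (marginal μ A) (cyl A F σ) = μ.real {ω | ∀ v ∈ F, ω v = σ v} := by
  rw [mass_marginal_cyl]
  congr 1
  ext ω
  exact ⟨fun h v hv => h v (hF hv) hv, fun h v _ hv => h v hv⟩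

theorem IsGibbsMeasure.exists_pos_le (hG : ∀ v, (G.neighborSet v).Finite) {s : χ}
    (hs : ∀ t, M.H t s ≠ ⊤) {μ : Measure (V → χ)} (hμ : IsGibbsMeasure G M μ) (X : Finset V) :
    ∃ c : ℝ, 0 < c ∧ ∀ F : Finset V, c * μ.real {ω | ∀ v ∈ F, ω v = s} ≤
      μ.real {ω | (∀ v ∈ X, ω v = s) ∧ ∀ v ∈ F, ω v = s} := by
  classical
  have := hμ.isProbabilityMeasure
  obtain ⟨c, hc, h⟩ := exists_pos_le_mass hG hs X
  refine ⟨c, hc, fun F => ?_⟩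
  have hloc := hμ.isLocallyGibbs (C := X) (A := X ∪ X.biUnion (fun v => (hG v).toFinset) ∪ F)
    (Finset.subset_union_left.trans Finset.subset_union_left) (by
      intro v hv u hvu
      refine Finset.mem_union_left _ (Finset.mem_union_right _ (Finset.mem_biUnion.2 ⟨v, hv, ?_⟩))
      simpa using hvu)
  have := h _ _ hloc F
  rw [cyl_inter_cyl, ← Finset.coe_union, mass_marginal_cyl_coe _ Finset.subset_union_right,
    mass_marginal_cyl_coe, setOf_forall_mem_union] at this
  · exact this
  · exact Finset.union_subset_union_left Finset.subset_union_left

/-- The conditional probabilities, given spins `s` on `Y`, of the event that the spins in the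
finite set `X` are equal to `s`, exist, are positive, and are approximated by those in finite
systems. -/
theorem IsGibbsMeasure.exists_hasCondProb (hSSM : StrongSpatialMixing G M)
    (hG : ∀ v, (G.neighborSet v).Finite) {s : χ} (hs : ∀ t, M.H t s ≠ ⊤)
    {μ : Measure (V → χ)} (hμ : IsGibbsMeasure G M μ) (X : Finset V) (Y : Set V) :
    ∃ p : ℝ, 0 < p ∧ HasCondProb μ {ω | ∀ v ∈ X, ω v = s} Y s p ∧
      ∀ ε > 0, ∃ B : Finset V, ∀ A : Finset V, B ⊆ A → ∀ F : Set V, (∀ v ∈ B, v ∈ F ↔ v ∈ Y) →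
        |weightOf G M A (cyl A (X ∪ F) fun _ => s) / weightOf G M A (cyl A F fun _ => s) - p|
          ≤ ε := by
  classical
  have := hμ.isProbabilityMeasure
  obtain ⟨R, q, hR, hq⟩ := hSSM.exists_estimate hG hs X Y fun _ => s
  have hpos : ∀ F : Finset V, 0 < μ.real {ω | ∀ v ∈ F, ω v = s} := by
    intro F
    obtain ⟨c, hc, h⟩ := hμ.exists_pos_le hG hs F
    have h' := h ∅
    simp only [Finset.notMem_empty, false_imp_iff, implies_true, and_true] at h'
    refine lt_of_lt_of_le ?_ h'
    have : ({ω | True} : Set (V → χ)) = Set.univ := rfl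
    simpa [this] using hc
  have hmeas : ∀ F : Finset V, MeasurableSet {ω : V → χ | ∀ v ∈ F, ω v = s} := by
    intro F
    have : {ω : V → χ | ∀ v ∈ F, ω v = s} = (fun (ω : V → χ) (v : F) => ω v) ⁻¹' {fun _ => s} := by
      ext ω
      simp [funext_iff]
    rw [this]
    exact measurable_restrict_coe F (measurableSet_singleton _)
  have hcond : ∀ F : Finset Y, (ProbabilityTheory.cond μ {ω | ∀ v ∈ F, ω (v : V) = s}).real
      {ω | ∀ v ∈ X, ω v = s} =
      μ.real {ω | (∀ v ∈ X, ω v = s) ∧ ∀ v ∈ F.map (Function.Embedding.subtype _), ω v = s} /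
        μ.real {ω | ∀ v ∈ F.map (Function.Embedding.subtype _), ω v = s} := by
    intro F
    have hF : {ω : V → χ | ∀ v ∈ F, ω (v : V) = s} =
        {ω | ∀ v ∈ F.map (Function.Embedding.subtype _), ω v = s} := by
      ext ω
      simp
    rw [hF, measureReal_def, ProbabilityTheory.cond_apply (hmeas _), ENNReal.toReal_mul,
      ENNReal.toReal_inv, inv_mul_eq_div, Set.inter_comm]
    rfl
  have hlim : ∀ r, 1 ≤ r → ∀ᶠ F : Finset Y in atTop,
      |(ProbabilityTheory.cond μ {ω | ∀ v ∈ F, ω (v : V) = s}).real {ω | ∀ v ∈ X, ω v = s} - q r|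
        ≤ R r := by
    intro r hr
    obtain ⟨B, C, hCB, hC, h⟩ := hq r hr
    -- Once `F ⊆ Y` contains all of `Y ∩ B`, it agrees with `Y` inside `B`.
    filter_upwards [eventually_ge_atTop (B.subtype (· ∈ Y))] with F hF
    set F' : Finset V := F.map (Function.Embedding.subtype _) with hF'
    have h' := h (B ∪ F' ∪ X) (Finset.subset_union_left.trans Finset.subset_union_left) _
      (hμ.isLocallyGibbs (hCB.trans (Finset.subset_union_left.trans Finset.subset_union_left))
        fun v hv u hvu => Finset.mem_union_left _ (Finset.mem_union_left _ (hC v hv u hvu)))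
      F' (by
        intro v hv
        refine ⟨fun hvF => ?_, fun hvY => ?_⟩
        · rw [Finset.mem_coe, hF', Finset.mem_map] at hvF
          obtain ⟨w, _, rfl⟩ := hvF
          exact w.2
        · rw [Finset.mem_coe, hF', Finset.mem_map]
          exact ⟨⟨v, hvY⟩, hF (by simpa using hv), rfl⟩)
    rw [cyl_inter_cyl, ← Finset.coe_union,
      mass_marginal_cyl_coe _ (Finset.subset_union_right.trans Finset.subset_union_left),
      mass_marginal_cyl_coe, setOf_forall_mem_union] at h'
    swap
    · exact Finset.union_subset Finset.subset_union_right
        (Finset.subset_union_right.trans Finset.subset_union_left)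
    rw [hcond, ← mul_le_mul_iff_left₀ (hpos F'), ← abs_of_pos (hpos F'), ← abs_mul,
      abs_of_pos (hpos F'), sub_mul, div_mul_cancel₀ _ (hpos F').ne']
    exact h'
  obtain ⟨p, hp, hpq⟩ := exists_tendsto_of_eventually_abs_sub_le hR hlim
  refine ⟨p, ?_, hp, fun ε hε => ?_⟩
  · obtain ⟨c, hc, h⟩ := hμ.exists_pos_le hG hs X
    refine hc.trans_le (ge_of_tendsto hp (.of_forall fun F => ?_))
    rw [hcond, le_div_iff₀ (hpos _)]
    exact h _
  · obtain ⟨r, hr1, hr⟩ :=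
      ((eventually_ge_atTop 1).and (hR.eventually (gt_mem_nhds (half_pos hε)))).exists
    obtain ⟨B, C, hCB, hC, h⟩ := hq r hr1
    refine ⟨B, fun A hA F hF => ?_⟩
    -- The finite Gibbs weights obey the estimate with the same `q r` as the marginals of `μ`. Each
    -- side is within `R r < ε / 2` of it.
    have h' := h A hA _ (isLocallyGibbs_weight G M A C) F hF
    have hpos : 0 < mass (weight G M A) (cyl A F fun _ => s) :=
      weightOf_cyl_const_pos G hs A F
    rw [cyl_inter_cyl] at h'
    have h'' : |weightOf G M A (cyl A (X ∪ F) fun _ => s) / weightOf G M A (cyl A F fun _ => s)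
        - q r| ≤ R r := by
      rw [← mul_le_mul_iff_left₀ hpos, ← abs_of_pos hpos, ← abs_mul,
        abs_of_pos hpos, sub_mul, weightOf_eq_mass, weightOf_eq_mass, div_mul_cancel₀ _ hpos.ne']
      exact h'
    have h3 := hpq r hr1
    rw [abs_le] at h3 h'' ⊢
    constructor <;> linarith [h3.1, h3.2, h''.1, h''.2]

/-- Strong spatial mixing implies that there is at most one Gibbs measure. -/
theorem IsGibbsMeasure.unique (hSSM : StrongSpatialMixing G M)
    (hG : ∀ v, (G.neighborSet v).Finite) {s : χ} (hs : ∀ t, M.H t s ≠ ⊤)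
    {μ ν : Measure (V → χ)} (hμ : IsGibbsMeasure G M μ) (hν : IsGibbsMeasure G M ν) : μ = ν := by
  classical
  have := hμ.isProbabilityMeasure
  have := hν.isProbabilityMeasure
  have hcyl : ∀ (X : Finset V) (σ : V → χ),
      μ.real {ω | ∀ v ∈ X, ω v = σ v} = ν.real {ω | ∀ v ∈ X, ω v = σ v} := by
    intro X σ
    -- With `Y = ∅` the estimate concerns unconditional probabilities, so any two Gibbs measures are
    -- within `2 * R r` of each other on each cylinder.
    obtain ⟨R, q, hR, hq⟩ := hSSM.exists_estimate hG hs X ∅ σ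
    have key : ∀ r, 1 ≤ r → ∀ ρ : Measure (V → χ), IsGibbsMeasure G M ρ →
        |ρ.real {ω | ∀ v ∈ X, ω v = σ v} - q r| ≤ R r := by
      intro r hr ρ hρ
      have := hρ.isProbabilityMeasure
      obtain ⟨B, C, hCB, hC, h⟩ := hq r hr
      have h' := h (B ∪ X) Finset.subset_union_left _
        (hρ.isLocallyGibbs (hCB.trans Finset.subset_union_left)
          fun v hv u hvu => Finset.mem_union_left _ (hC v hv u hvu)) ∅ (fun _ _ => Iff.rfl)
      have e1 : cyl (B ∪ X) (∅ : Set V) (fun _ => s) = Set.univ := by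
        ext τ
        simp [cyl]
      have e2 : mass (marginal ρ (B ∪ X)) Set.univ = 1 := by
        rw [mass_marginal]
        exact probReal_univ
      rw [e1, e2, Set.inter_univ, mul_one, mul_one,
        mass_marginal_cyl_coe _ Finset.subset_union_right] at h'
      exact h'
    have h0 : Tendsto (fun r => 2 * R r) atTop (𝓝 0) := by simpa using hR.const_mul 2
    have : |μ.real {ω | ∀ v ∈ X, ω v = σ v} - ν.real {ω | ∀ v ∈ X, ω v = σ v}| ≤ 0 := by
      refine ge_of_tendsto h0 ?_
      filter_upwards [eventually_ge_atTop 1] with r hr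
      have h1 := abs_le.1 (key r hr μ hμ)
      have h2 := abs_le.1 (key r hr ν hν)
      rw [abs_le]
      constructor <;> linarith [h1.1, h1.2, h2.1, h2.2]
    exact sub_eq_zero.1 (abs_nonpos_iff.1 this)
  refine IsProjectiveLimit.unique (P := fun X => ν.map X.restrict) (fun X => ?_) fun X => rfl
  refine Measure.ext_of_singleton fun τ => ?_
  obtain ⟨σ, rfl⟩ := exists_extension s X τ
  rw [Measure.map_apply (Finset.measurable_restrict X) (measurableSet_singleton _),
    Measure.map_apply (Finset.measurable_restrict X) (measurableSet_singleton _)]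
  have e : (X.restrict : (V → χ) → X → χ) ⁻¹' {fun v : X => σ v} =
      {ω : V → χ | ∀ v ∈ X, ω v = σ v} := by
    ext ω
    simp [funext_iff]
  rw [e]
  exact (measureReal_eq_measureReal_iff).1 (hcyl X σ)

end GibbsMeasures

/-! ### Existence of a Gibbs measure by compactness -/

section Existence

variable {V χ : Type*} [Fintype χ] {G : SimpleGraph V} {M : Model χ}

/-- The DLR identity in finite volume. Conditioning on all of `Δ \ Λ` leaves a single feasible
boundary condition, so `IsLocallyGibbs.bounds` applies with `a = b` and yields an equality. -/
theorem mass_weight_cyl_eq_finCondProb_mul (s : χ) {A Δ Λ : Finset V} (hΔA : Δ ⊆ A) (hΛΔ : Λ ⊆ Δ)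
    (hΛ : ∀ v ∈ Λ, ∀ u, G.Adj v u → u ∈ Δ) (σ : V → χ) :
    weightOf G M A (cyl A Δ σ) =
      finCondProb G M Δ {τ | ∀ v : Δ, (v : V) ∈ Λ → τ v = σ v}
          {τ | ∀ v : Δ, (v : V) ∉ Λ → τ v = σ v} * weightOf G M A (cyl A (Δ \ Λ) σ) := by
  have h := (isLocallyGibbs_weight G M A Λ).bounds s hΔA hΛΔ (fun v hv u _ => hΛ v hv u)
    Λ (Δ \ Λ) (fun v _ hv => hΛΔ hv) σ σ
    (a := finCondProb G M Δ (cyl Δ Λ σ) (cyl Δ (Λ : Set V)ᶜ σ))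
    (b := finCondProb G M Δ (cyl Δ Λ σ) (cyl Δ (Λ : Set V)ᶜ σ)) ?_
  · have h1 : cyl A (Λ : Set V) σ ∩ cyl A (Δ \ Λ) σ = cyl A Δ σ := by
      rw [cyl_inter_cyl, Set.union_sdiff_cancel (by exact_mod_cast hΛΔ)]
    rw [h1] at h
    exact le_antisymm h.2 h.1
  · intro s3 h3
    obtain ⟨τ, hτ, -⟩ := exists_of_mass_ne_zero h3
    have h4 : cyl Δ (Δ \ Λ) σ ∩ cyl Δ (Λ : Set V)ᶜ s3 = cyl Δ (Λ : Set V)ᶜ σ := by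
      ext τ'
      refine ⟨fun h v hv => h.1 v ⟨v.2, hv⟩, fun h => ⟨fun v hv => h v hv.2, fun v hv => ?_⟩⟩
      rw [h v hv, ← hτ.1 v ⟨v.2, hv⟩, hτ.2 v hv]
    rw [h4]
    exact ⟨le_rfl, le_rfl⟩

variable [MeasurableSpace χ] [DiscreteMeasurableSpace χ]

/-- The finite Gibbs measure on `A`, with the spins outside of `A` equal to `s`, as a probability
measure on all configurations. -/
theorem exists_probabilityMeasure_weightOf (G : SimpleGraph V) {s : χ} (hs : ∀ t, M.H t s ≠ ⊤)
    (A : Finset V) :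
    ∃ P : ProbabilityMeasure (V → χ), ∀ S : Set (A → χ),
      (P : Measure (V → χ)).real {ω | (fun v : A => ω v) ∈ S} =
        weightOf G M A S / partitionFunction G M A := by
  classical
  have hZ : 0 < partitionFunction G M A :=
    mass_pos (weight_nonneg G M A) (Set.mem_univ _) (weight_const_ne_zero G hs A)
  let ext : (A → χ) → V → χ := fun τ v => if h : v ∈ A then τ ⟨v, h⟩ else s
  let μ : Measure (V → χ) := ∑ τ : A → χ,
    ENNReal.ofReal (weight G M A τ / partitionFunction G M A) • Measure.dirac (ext τ)
  have hμ : ∀ S : Set (A → χ), μ {ω | (fun v : A => ω v) ∈ S} =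
      ENNReal.ofReal (weightOf G M A S / partitionFunction G M A) := by
    intro S
    have hS : MeasurableSet {ω : V → χ | (fun v : A => ω v) ∈ S} :=
      measurable_restrict_coe A (Set.toFinite S).measurableSet
    have hmem : ∀ τ, ext τ ∈ {ω : V → χ | (fun v : A => ω v) ∈ S} ↔ τ ∈ S := by
      intro τ
      have : (fun v : A => ext τ v) = τ := by
        ext v
        simp [ext]
      rw [Set.mem_ofPred_eq, this]
    simp only [μ, Measure.finsetSum_apply, Measure.smul_apply, Measure.dirac_apply' _ hS,
      smul_eq_mul]
    rw [weightOf, Finset.sum_div, ENNReal.ofReal_sum_of_nonneg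
      fun τ _ => div_nonneg (weight_nonneg G M A τ) hZ.le, Finset.sum_filter]
    refine Finset.sum_congr rfl fun τ _ => ?_
    by_cases h : τ ∈ S
    · rw [Set.indicator_of_mem ((hmem τ).2 h), if_pos h, Pi.one_apply, mul_one]
    · rw [Set.indicator_of_notMem fun h' => h ((hmem τ).1 h'), if_neg h, mul_zero]
  have hprob : IsProbabilityMeasure μ := by
    constructor
    have := hμ Set.univ
    have h1 : weightOf G M A Set.univ / partitionFunction G M A = 1 := div_self hZ.ne'
    rw [h1, ENNReal.ofReal_one] at this
    exact this
  refine ⟨⟨μ, hprob⟩, fun S => ?_⟩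
  change μ.real _ = _
  rw [measureReal_def, hμ S, ENNReal.toReal_ofReal]
  exact div_nonneg (mass_nonneg (weight_nonneg G M A) _) hZ.le

/-- A limit point of the finite Gibbs measures is a Gibbs measure. -/
theorem exists_isGibbsMeasure [Countable V] (G : SimpleGraph V) {s : χ}
    (hs : ∀ t, M.H t s ≠ ⊤) : ∃ μ : Measure (V → χ), IsGibbsMeasure G M μ := by
  classical
  let _ : TopologicalSpace χ := ⊥
  have _ : DiscreteTopology χ := ⟨rfl⟩
  choose P hP using exists_probabilityMeasure_weightOf (M := M) G hs
  -- With `χ` finite and discrete, the probability measures on `V → χ` form a compact space, so an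
  -- ultrafilter finer than `atTop` gives a limit. Cylinders are clopen, so their probabilities
  -- converge and the finite volume identities pass to it.
  let 𝒰 : Ultrafilter (Finset V) := Ultrafilter.of atTop
  let μ : ProbabilityMeasure (V → χ) := (𝒰.map P).lim
  have hlim : Tendsto P 𝒰 (𝓝 μ) := (𝒰.map P).le_nhds_lim
  have hcyl : ∀ (F : Finset V) (σ : V → χ), Tendsto
      (fun A => weightOf G M A (cyl A F σ) / partitionFunction G M A) 𝒰
      (𝓝 ((μ : Measure (V → χ)).real {ω | ∀ v ∈ F, ω v = σ v})) := by
    intro F σ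
    have hopen : IsClopen {ω : V → χ | ∀ v ∈ F, ω v = σ v} := by
      have : {ω : V → χ | ∀ v ∈ F, ω v = σ v} = ⋂ v ∈ F, (fun ω : V → χ => ω v) ⁻¹' {σ v} := by
        ext ω
        simp
      rw [this]
      exact F.finite_toSet.isClopen_biInter fun v _ =>
        (isClopen_discrete _).preimage (continuous_apply v)
    have h := (NNReal.tendsto_coe.2
      (ProbabilityMeasure.tendsto_measure_of_isClopen_of_tendsto hlim hopen))
    refine Tendsto.congr' ?_ h
    have hF : ∀ᶠ A in (𝒰 : Filter (Finset V)), F ⊆ A :=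
      Ultrafilter.of_le atTop (eventually_ge_atTop F)
    filter_upwards [hF] with A hA
    rw [← hP]
    change (P A : Measure (V → χ)).real _ = _
    congr 1
    ext ω
    exact ⟨fun h v hv => h v hv, fun h v hv => h ⟨v, hA hv⟩ hv⟩
  refine ⟨μ, inferInstance, fun Λ Δ hΛΔ hΛ σ => ?_⟩
  refine tendsto_nhds_unique (hcyl Δ σ) ?_
  have h2 := (hcyl (Δ \ Λ) σ).const_mul (finCondProb G M Δ
    {τ | ∀ v : Δ, (v : V) ∈ Λ → τ v = σ v} {τ | ∀ v : Δ, (v : V) ∉ Λ → τ v = σ v})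
  have e : {ω : V → χ | ∀ v ∈ Δ \ Λ, ω v = σ v} = {ω | ∀ v ∈ Δ, v ∉ Λ → ω v = σ v} := by
    ext ω
    simp
  rw [e] at h2
  refine h2.congr' ?_
  have hΔ : ∀ᶠ A in (𝒰 : Filter (Finset V)), Δ ⊆ A :=
    Ultrafilter.of_le atTop (eventually_ge_atTop Δ)
  filter_upwards [hΔ] with A hA
  rw [mass_weight_cyl_eq_finCondProb_mul s hA hΛΔ hΛ, Finset.coe_sdiff, mul_div_assoc]

end Existence

/-! ### Invariance under automorphisms, and the chain rule -/

section Invariance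

variable {V χ : Type*} {G : SimpleGraph V} {M : Model χ}

theorem weight_map_iso (φ : G ≃g G) (A : Finset V) (σ : V → χ) :
    weight G M (A.map φ.toEquiv.toEmbedding) (fun v => σ v) =
      weight G M A (fun v => σ (φ v)) := by
  classical
  have h1 := energy_restrict G M A fun v => σ (φ v)
  unfold weight
  rw [h1, energy_restrict, Finset.sum_map, Finset.sym2_map, Finset.filter_map, Finset.sum_map]
  congr 2
  refine Finset.sum_congr ?_ ?_
  · ext e
    induction e with
    | _ u v =>
      have h : G.Adj (φ u) (φ v) ↔ G.Adj u v := φ.map_adj_iff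
      simp [h]
  · intro e _
    induction e with
    | _ u v => rfl

variable [Fintype χ]

/-- Only finite systems are ever translated; translation invariance of the Gibbs measure is not
needed. -/
theorem weightOf_map_iso (φ : G ≃g G) (A : Finset V) (F : Set V) (s : χ) :
    weightOf G M (A.map φ.toEquiv.toEmbedding) (cyl _ F fun _ => s) =
      weightOf G M A (cyl A (φ ⁻¹' F) fun _ => s) := by
  classical
  have hmem : ∀ v : A, φ v ∈ A.map φ.toEquiv.toEmbedding := fun v =>
    Finset.mem_map_of_mem φ.toEquiv.toEmbedding v.2
  have hmem' : ∀ v : A.map φ.toEquiv.toEmbedding, φ.symm v ∈ A := by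
    intro v
    obtain ⟨w, hw, h⟩ := Finset.mem_map.1 v.2
    rw [← h]
    simpa using hw
  unfold weightOf
  refine Finset.sum_bij' (fun τ _ => fun v => τ ⟨φ v, hmem v⟩)
    (fun τ _ => fun v => τ ⟨φ.symm v, hmem' v⟩) ?_ ?_ ?_ ?_ ?_
  · intro τ hτ
    simp only [Finset.mem_filter, Finset.mem_univ, true_and] at hτ ⊢
    exact fun v hv => hτ _ hv
  · intro τ hτ
    simp only [Finset.mem_filter, Finset.mem_univ, true_and] at hτ ⊢
    intro v hv
    refine hτ _ ?_
    simpa using hv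
  · intro τ _
    ext v
    simp
  · intro τ _
    ext v
    simp
  · intro τ _
    obtain ⟨σ, rfl⟩ := exists_extension s _ τ
    exact weight_map_iso φ A σ

/-- The chain rule for the conditional probabilities of the events that the spins in `X i` are
equal to `s`, given those with larger indices. -/
theorem sum_log_weightOf_div {ι L : Type*} [LinearOrder L] {f : ι → L}
    (hf : Function.Injective f) (G : SimpleGraph V) {s : χ} (hs : ∀ t, M.H t s ≠ ⊤) (A : Finset V)
    (X : ι → Set V) (S : Finset ι) :
    ∑ i ∈ S, Real.log (weightOf G M A (cyl A (X i ∪ ⋃ j ∈ {j | j ∈ S ∧ f i < f j}, X j) fun _ => s) /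
        weightOf G M A (cyl A (⋃ j ∈ {j | j ∈ S ∧ f i < f j}, X j) fun _ => s)) =
      Real.log (weightOf G M A (cyl A (⋃ j ∈ S, X j) fun _ => s)) -
        Real.log (partitionFunction G M A) := by
  classical
  have hpos : ∀ F : Set V, weightOf G M A (cyl A F fun _ => s) ≠ 0 := fun F =>
    (weightOf_cyl_const_pos G hs A F).ne'
  -- A new minimal index is conditioned on all of `S` and enters no earlier condition, so the sum
  -- telescopes.
  induction S using Finset.induction_on_min_value f with
  | empty =>
    have : cyl A (∅ : Set V) (fun _ => s) = Set.univ := by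
      ext τ
      simp [cyl]
    simp [this, partitionFunction]
  | insert a S ha hmin ih =>
    have hlt : ∀ x ∈ S, f a < f x := fun x hx =>
      lt_of_le_of_ne (hmin x hx) fun h => ha (hf h ▸ hx)
    rw [Finset.sum_insert ha]
    have h1 : (⋃ j ∈ {j | j ∈ insert a S ∧ f a < f j}, X j) = ⋃ j ∈ S, X j := by
      refine Set.iUnion_congr fun j => Set.iUnion_congr_Prop ?_ fun _ => rfl
      simp only [Set.mem_ofPred_eq, Finset.mem_insert]
      refine ⟨fun h => h.1.resolve_left ?_, fun h => ⟨.inr h, hlt j h⟩⟩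
      rintro rfl
      exact lt_irrefl _ h.2
    have h2 : ∀ i ∈ S, {j | j ∈ insert a S ∧ f i < f j} = {j | j ∈ S ∧ f i < f j} := by
      intro i hi
      ext j
      simp only [Set.mem_ofPred_eq, Finset.mem_insert, and_congr_left_iff, or_iff_right_iff_imp]
      rintro h rfl
      exact absurd h (hlt i hi).le.not_gt
    have h3 : ∑ i ∈ S, Real.log (weightOf G M A
          (cyl A (X i ∪ ⋃ j ∈ {j | j ∈ insert a S ∧ f i < f j}, X j) fun _ => s) /
        weightOf G M A (cyl A (⋃ j ∈ {j | j ∈ insert a S ∧ f i < f j}, X j) fun _ => s)) =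
        ∑ i ∈ S, Real.log (weightOf G M A
          (cyl A (X i ∪ ⋃ j ∈ {j | j ∈ S ∧ f i < f j}, X j) fun _ => s) /
        weightOf G M A (cyl A (⋃ j ∈ {j | j ∈ S ∧ f i < f j}, X j) fun _ => s)) := by
      refine Finset.sum_congr rfl fun i hi => ?_
      rw [h2 i hi]
    rw [h3, ih, h1, Real.log_div (hpos _) (hpos _), Finset.set_biUnion_insert]
    ring

end Invariance

/-! ### Geometry of the lattice and boundary estimates -/

section Lattice

variable {d : ℕ}

theorem lattice_adj {v u : Fin d → ℤ} :
    (lattice d).Adj v u ↔ ∑ i, |v i - u i| = 1 := Iff.rfl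

/-- The `2 d` unit vectors of `ℤ ^ d`. -/
def unitVector (p : Fin d × Bool) : Fin d → ℤ := Pi.single p.1 (if p.2 then 1 else -1)

theorem unitVector_injective : Function.Injective (unitVector (d := d)) := by
  rintro ⟨i, a⟩ ⟨j, b⟩ h
  have hi := congrFun h i
  by_cases hij : i = j
  · subst hij
    cases a <;> cases b <;> simp [unitVector] at hi ⊢
  · cases a <;> simp [unitVector, hij] at hi

theorem lattice_adj_iff {v u : Fin d → ℤ} :
    (lattice d).Adj v u ↔ ∃ p : Fin d × Bool, u = v + unitVector p := by
  rw [lattice_adj]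
  constructor
  · intro h
    obtain ⟨i, -, hi⟩ : ∃ i ∈ Finset.univ, |v i - u i| ≠ 0 :=
      Finset.exists_ne_zero_of_sum_ne_zero (by rw [h]; exact one_ne_zero)
    have h1 : 1 ≤ |v i - u i| := Int.one_le_abs (by simpa using hi)
    rw [← Finset.add_sum_erase _ _ (Finset.mem_univ i)] at h
    have h0 : 0 ≤ ∑ j ∈ Finset.univ.erase i, |v j - u j| :=
      Finset.sum_nonneg fun j _ => abs_nonneg _
    have hz : ∑ j ∈ Finset.univ.erase i, |v j - u j| = 0 := by omega
    rw [Finset.sum_eq_zero_iff_of_nonneg fun j _ => abs_nonneg _] at hz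
    have hi1 : |v i - u i| = 1 := by omega
    refine ⟨(i, decide (v i - u i = -1)), ?_⟩
    ext j
    by_cases hj : j = i
    · subst hj
      rcases (abs_eq one_pos.le).1 hi1 with h2 | h2 <;> simp [unitVector, h2] <;> omega
    · have := hz j (Finset.mem_erase.2 ⟨hj, Finset.mem_univ j⟩)
      rw [abs_eq_zero] at this
      simp [unitVector, hj]
      omega
  · rintro ⟨⟨i, b⟩, rfl⟩
    rw [Finset.sum_eq_single i]
    · cases b <;> simp [unitVector]
    · intro j _ hj
      simp [unitVector, hj]
    · simp

theorem lattice_neighborSet_finite (v : Fin d → ℤ) : ((lattice d).neighborSet v).Finite := by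
  refine (Set.finite_range fun p : Fin d × Bool => v + unitVector p).subset ?_
  intro u hu
  obtain ⟨p, rfl⟩ := lattice_adj_iff.1 hu
  exact ⟨p, rfl⟩

/-- The translation of the lattice by `v`. -/
def shift (v : Fin d → ℤ) : lattice d ≃g lattice d where
  toEquiv := Equiv.addRight v
  map_rel_iff' := by
    intro a b
    simp [lattice_adj]

theorem shift_apply (v u : Fin d → ℤ) : shift v u = u + v := rfl

theorem coe_shift_lineGraph (v : Fin d → ℤ) (e : LatticeEdge d) :
    (((shift v).lineGraph e : LatticeEdge d) : Sym2 (Fin d → ℤ)) =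
      (e : Sym2 (Fin d → ℤ)).map (· + v) := rfl

theorem mem_edgesIn {Λ : Finset (Fin d → ℤ)} {e : LatticeEdge d} :
    e ∈ edgesIn d Λ ↔ ∀ v ∈ (e : Sym2 (Fin d → ℤ)), v ∈ Λ := by
  simp only [edgesIn, Finset.mem_subtype, Finset.mem_sym2_iff]

theorem edgesIn_map_shift (v : Fin d → ℤ) (Λ : Finset (Fin d → ℤ)) :
    edgesIn d (Λ.map (shift v).toEquiv.toEmbedding) =
      (edgesIn d Λ).map (shift v).lineGraph.toEquiv.toEmbedding := by
  ext e
  obtain ⟨e', rfl⟩ := (shift v).lineGraph.surjective e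
  have h1 : (shift v).lineGraph e' ∈ (edgesIn d Λ).map (shift v).lineGraph.toEquiv.toEmbedding ↔
      e' ∈ edgesIn d Λ :=
    Finset.mem_map' (shift v).lineGraph.toEquiv.toEmbedding
  rw [h1, mem_edgesIn, mem_edgesIn, coe_shift_lineGraph]
  simp only [Sym2.mem_map, forall_exists_index, and_imp, forall_apply_eq_imp_iff₂]
  refine forall_congr' fun u => forall_congr' fun _ => ?_
  exact Finset.mem_map' (shift v).toEquiv.toEmbedding

theorem edges_at_finite (v : Fin d → ℤ) :
    {e : LatticeEdge d | v ∈ (e : Sym2 (Fin d → ℤ))}.Finite := by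
  refine Set.Finite.of_finite_image (f := Subtype.val) ?_ Subtype.val_injective.injOn
  refine ((lattice_neighborSet_finite v).image fun u => s(v, u)).subset ?_
  rintro _ ⟨⟨e, he⟩, hv, rfl⟩
  obtain ⟨u, rfl⟩ := hv
  exact ⟨u, he, rfl⟩

theorem edgeGraph_neighborSet_finite (e : LatticeEdge d) :
    ((edgeGraph d).neighborSet e).Finite := by
  classical
  refine (Set.Finite.biUnion (e : Sym2 (Fin d → ℤ)).toFinset.finite_toSet fun v _ =>
    edges_at_finite v).subset ?_
  intro e' he'
  obtain ⟨-, v, hv, hv'⟩ := SimpleGraph.lineGraph_adj_iff_exists.1 he'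
  exact Set.mem_biUnion (by simpa using hv) hv'

/-! ### Boundaries -/

open Classical in
/-- The number of boundary nodes of a finite set of nodes. -/
noncomputable def boundaryCard (Λ : Finset (Fin d → ℤ)) : ℕ :=
  (Λ.filter (· ∈ boundary (lattice d) (Λ : Set (Fin d → ℤ)))).card

theorem boundary_ncard (Λ : Finset (Fin d → ℤ)) :
    (boundary (lattice d) (Λ : Set (Fin d → ℤ))).ncard = boundaryCard Λ := by
  classical
  rw [boundaryCard, ← Set.ncard_coe_finset]
  congr 1
  ext v
  simp only [Finset.coe_filter, Set.mem_ofPred_eq]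
  exact ⟨fun h => ⟨h.1, h⟩, fun h => h.2⟩

open Classical in
-- The shifts with such a bound are closed under addition: on the way to `v + (x + y)`, the set is
-- left either in the step by `x` or in the step by `y`. A unit step leaves `Λ` only from a boundary
-- node, and unit vectors generate the lattice.
theorem exists_card_escape_le (x : Fin d → ℤ) :
    ∃ C : ℕ, ∀ Λ : Finset (Fin d → ℤ), (Λ.filter (· + x ∉ Λ)).card ≤ C * boundaryCard Λ := by
  have hadd : ∀ x y : Fin d → ℤ,
      (∃ C : ℕ, ∀ Λ : Finset (Fin d → ℤ), (Λ.filter (· + x ∉ Λ)).card ≤ C * boundaryCard Λ) →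
      (∃ C : ℕ, ∀ Λ : Finset (Fin d → ℤ), (Λ.filter (· + y ∉ Λ)).card ≤ C * boundaryCard Λ) →
      ∃ C : ℕ, ∀ Λ : Finset (Fin d → ℤ), (Λ.filter (· + (x + y) ∉ Λ)).card ≤
        C * boundaryCard Λ := by
    rintro x y ⟨C, hC⟩ ⟨C', hC'⟩
    refine ⟨C + C', fun Λ => ?_⟩
    have hsub : (Λ.filter (· + (x + y) ∉ Λ)) ⊆ Λ.filter (· + x ∉ Λ) ∪
        ((Λ.filter (· + y ∉ Λ)).image (· - x)) := by
      intro v hv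
      rw [Finset.mem_filter] at hv
      rw [Finset.mem_union, Finset.mem_filter, Finset.mem_image]
      by_cases h : v + x ∈ Λ
      · exact .inr ⟨v + x, Finset.mem_filter.2 ⟨h, by rw [add_assoc]; exact hv.2⟩, by simp⟩
      · exact .inl ⟨hv.1, h⟩
    calc _ ≤ _ := Finset.card_le_card hsub
      _ ≤ _ := Finset.card_union_le _ _
      _ ≤ C * boundaryCard Λ + C' * boundaryCard Λ :=
        add_le_add (hC Λ) (Finset.card_image_le.trans (hC' Λ))
      _ = _ := by ring
  have hzero : ∃ C : ℕ, ∀ Λ : Finset (Fin d → ℤ),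
      (Λ.filter (· + (0 : Fin d → ℤ) ∉ Λ)).card ≤ C * boundaryCard Λ :=
    ⟨0, fun Λ => by simp⟩
  have hunit : ∀ p : Fin d × Bool, ∃ C : ℕ, ∀ Λ : Finset (Fin d → ℤ),
      (Λ.filter (· + unitVector p ∉ Λ)).card ≤ C * boundaryCard Λ := by
    refine fun p => ⟨1, fun Λ => ?_⟩
    rw [one_mul]
    refine Finset.card_le_card fun v hv => ?_
    rw [Finset.mem_filter] at hv ⊢
    exact ⟨hv.1, hv.1, v + unitVector p, lattice_adj_iff.2 ⟨p, rfl⟩, hv.2⟩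
  have hsingle : ∀ (i : Fin d) (n : ℤ), ∃ C : ℕ, ∀ Λ : Finset (Fin d → ℤ),
      (Λ.filter (· + Pi.single i n ∉ Λ)).card ≤ C * boundaryCard Λ := by
    intro i n
    induction n with
    | zero => simpa using hzero
    | succ n ih =>
      rw [Pi.single_add]
      exact hadd _ _ ih (hunit (i, true))
    | pred n ih =>
      rw [sub_eq_add_neg, Pi.single_add]
      exact hadd _ _ ih (hunit (i, false))
  rw [← Finset.univ_sum_single x]
  exact Finset.sum_induction _
    (fun x => ∃ C : ℕ, ∀ Λ : Finset (Fin d → ℤ), (Λ.filter (· + x ∉ Λ)).card ≤ C * boundaryCard Λ)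
    hadd hzero fun i _ => hsingle i _

open Classical in
theorem exists_card_escape_finset_le (D : Finset (Fin d → ℤ)) :
    ∃ C : ℕ, ∀ Λ : Finset (Fin d → ℤ), (Λ.filter fun v => ∃ x ∈ D, v + x ∉ Λ).card ≤
      C * boundaryCard Λ := by
  choose C hC using exists_card_escape_le (d := d)
  refine ⟨∑ x ∈ D, C x, fun Λ => ?_⟩
  have hsub : (Λ.filter fun v => ∃ x ∈ D, v + x ∉ Λ) ⊆ D.biUnion fun x => Λ.filter (· + x ∉ Λ) := by
    intro v hv
    rw [Finset.mem_filter] at hv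
    obtain ⟨hv, x, hx, h⟩ := hv
    exact Finset.mem_biUnion.2 ⟨x, hx, Finset.mem_filter.2 ⟨hv, h⟩⟩
  rw [Finset.sum_mul]
  exact (Finset.card_le_card hsub).trans (Finset.card_biUnion_le.trans
    (Finset.sum_le_sum fun x _ => hC x Λ))

/-- `F Λ` is `a |Λ|`, up to an arbitrarily small fraction of `|Λ|` and a boundary term. -/
def HasDensity (F : Finset (Fin d → ℤ) → ℝ) (a : ℝ) : Prop :=
  ∀ ε > 0, ∃ C : ℝ, ∀ Λ, |F Λ - a * Λ.card| ≤ ε * Λ.card + C * boundaryCard Λ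

theorem HasDensity.add {F F' : Finset (Fin d → ℤ) → ℝ} {a a' : ℝ} (h : HasDensity F a)
    (h' : HasDensity F' a') : HasDensity (fun Λ => F Λ + F' Λ) (a + a') := by
  intro ε hε
  obtain ⟨C, hC⟩ := h (ε / 2) (half_pos hε)
  obtain ⟨C', hC'⟩ := h' (ε / 2) (half_pos hε)
  refine ⟨C + C', fun Λ => ?_⟩
  calc |F Λ + F' Λ - (a + a') * Λ.card|
      = |(F Λ - a * Λ.card) + (F' Λ - a' * Λ.card)| := by ring_nf
    _ ≤ |F Λ - a * Λ.card| + |F' Λ - a' * Λ.card| := abs_add_le _ _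
    _ ≤ _ := add_le_add (hC Λ) (hC' Λ)
    _ = _ := by ring

theorem HasDensity.const_mul {F : Finset (Fin d → ℤ) → ℝ} {a : ℝ} (h : HasDensity F a) (b : ℝ) :
    HasDensity (fun Λ => b * F Λ) (b * a) := by
  intro ε hε
  have hb : 0 < |b| + 1 := by positivity
  obtain ⟨C, hC⟩ := h (ε / (|b| + 1)) (div_pos hε hb)
  refine ⟨|b| * C, fun Λ => ?_⟩
  calc |b * F Λ - b * a * Λ.card| = |b| * |F Λ - a * Λ.card| := by
        rw [← abs_mul]
        ring_nf
    _ ≤ |b| * (ε / (|b| + 1) * Λ.card + C * boundaryCard Λ) :=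
        mul_le_mul_of_nonneg_left (hC Λ) (abs_nonneg b)
    _ = (|b| / (|b| + 1)) * (ε * Λ.card) + |b| * C * boundaryCard Λ := by ring
    _ ≤ 1 * (ε * Λ.card) + |b| * C * boundaryCard Λ := by
        gcongr
        rw [div_le_one hb]
        linarith
    _ = _ := by ring

theorem hasDensity_of_abs_le {F : Finset (Fin d → ℤ) → ℝ} {a C : ℝ}
    (h : ∀ Λ, |F Λ - a * Λ.card| ≤ C * boundaryCard Λ) : HasDensity F a :=
  fun ε hε => ⟨C, fun Λ => (h Λ).trans (le_add_of_nonneg_left (by positivity))⟩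

theorem HasDensity.tendsto {F : Finset (Fin d → ℤ) → ℝ} {a : ℝ} (h : HasDensity F a)
    {Λ : ℕ → Finset (Fin d → ℤ)} (hΛ : ∀ n, (Λ n).Nonempty)
    (hb : Tendsto (fun n => ((boundary (lattice d) (Λ n : Set (Fin d → ℤ))).ncard : ℝ) /
      (Λ n).card) atTop (𝓝 0)) :
    Tendsto (fun n => F (Λ n) / (Λ n).card) atTop (𝓝 a) := by
  rw [Metric.tendsto_atTop]
  intro ε hε
  obtain ⟨C, hC⟩ := h (ε / 2) (half_pos hε)
  have hC0 : Tendsto (fun n => C * (((boundary (lattice d) (Λ n : Set (Fin d → ℤ))).ncard : ℝ) /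
      (Λ n).card)) atTop (𝓝 0) := by simpa using hb.const_mul C
  obtain ⟨N, hN⟩ := eventually_atTop.1 (hC0.eventually (gt_mem_nhds (half_pos hε)))
  refine ⟨N, fun n hn => ?_⟩
  have hpos : (0 : ℝ) < (Λ n).card := by exact_mod_cast (hΛ n).card_pos
  have h1 := hN n hn
  rw [boundary_ncard] at h1
  rw [Real.dist_eq]
  have h2 : F (Λ n) / (Λ n).card - a = (F (Λ n) - a * (Λ n).card) / (Λ n).card := by
    field_simp
  rw [h2, abs_div, abs_of_pos hpos]
  calc _ ≤ (ε / 2 * (Λ n).card + C * boundaryCard (Λ n)) / (Λ n).card := by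
        gcongr
        exact hC _
    _ = ε / 2 + C * (boundaryCard (Λ n) / (Λ n).card) := by field_simp
    _ < ε := by linarith

/-- A sum over `Λ` of a bounded function that is constant off the boundary. -/
theorem abs_sum_sub_le (Λ : Finset (Fin d → ℤ)) {f : (Fin d → ℤ) → ℝ} {a K : ℝ}
    (h : ∀ v ∈ Λ, v ∉ boundary (lattice d) (Λ : Set (Fin d → ℤ)) → f v = a)
    (hK : ∀ v ∈ Λ, |f v - a| ≤ K) : |∑ v ∈ Λ, f v - a * Λ.card| ≤ K * boundaryCard Λ := by
  classical
  have h1 : ∑ v ∈ Λ, f v - a * Λ.card = ∑ v ∈ Λ, (f v - a) := by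
    rw [Finset.sum_sub_distrib, Finset.sum_const, nsmul_eq_mul, mul_comm]
  have h2 : ∑ v ∈ Λ, (f v - a) =
      ∑ v ∈ Λ.filter (· ∈ boundary (lattice d) (Λ : Set (Fin d → ℤ))), (f v - a) := by
    rw [Finset.sum_filter]
    refine Finset.sum_congr rfl fun v hv => ?_
    split_ifs with hb
    · rfl
    · rw [h v hv hb, sub_self]
  rw [h1, h2]
  refine (Finset.abs_sum_le_sum_abs _ _).trans ?_
  refine (Finset.sum_le_card_nsmul _ _ K fun v hv => hK v (Finset.mem_filter.1 hv).1).trans ?_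
  rw [nsmul_eq_mul, mul_comm, boundaryCard]

end Lattice

/-! ### Numbers of edges and of touching pairs of edges -/

section Counting

variable {d : ℕ}

open Classical in
/-- The edges at the node `v` with both end points in `Λ`. -/
noncomputable def edgesAt (Λ : Finset (Fin d → ℤ)) (v : Fin d → ℤ) : Finset (LatticeEdge d) :=
  (edgesIn d Λ).filter fun e => v ∈ (e : Sym2 (Fin d → ℤ))

open Classical in
theorem card_edgesAt {Λ : Finset (Fin d → ℤ)} {v : Fin d → ℤ} (hv : v ∈ Λ) :
    (edgesAt Λ v).card = (Finset.univ.filter fun p => v + unitVector p ∈ Λ).card := by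
  symm
  refine Finset.card_bij (fun p _ => ⟨s(v, v + unitVector p), lattice_adj_iff.2 ⟨p, rfl⟩⟩) ?_ ?_ ?_
  · intro p hp
    simp only [Finset.mem_filter, Finset.mem_univ, true_and] at hp
    simp [edgesAt, mem_edgesIn, hv, hp]
  · intro p _ q _ h
    have h' := congrArg Subtype.val h
    simp only [Sym2.congr_right, add_right_inj] at h'
    exact unitVector_injective h'
  · rintro ⟨e, he⟩ h
    simp only [edgesAt, Finset.mem_filter, mem_edgesIn] at h
    obtain ⟨u, rfl⟩ := h.2
    obtain ⟨p, hp⟩ := lattice_adj_iff.1 he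
    dsimp only at hp
    subst hp
    exact ⟨p, by simpa using h.1 _ (Sym2.mem_mk_right _ _), rfl⟩

theorem card_edgesAt_le {Λ : Finset (Fin d → ℤ)} {v : Fin d → ℤ} (hv : v ∈ Λ) :
    (edgesAt Λ v).card ≤ 2 * d := by
  classical
  rw [card_edgesAt hv]
  refine (Finset.card_filter_le _ _).trans ?_
  simp [mul_comm]

theorem card_edgesAt_of_notMem_boundary {Λ : Finset (Fin d → ℤ)} {v : Fin d → ℤ} (hv : v ∈ Λ)
    (hb : v ∉ boundary (lattice d) (Λ : Set (Fin d → ℤ))) : (edgesAt Λ v).card = 2 * d := by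
  classical
  rw [card_edgesAt hv, Finset.filter_true_of_mem]
  · simp [mul_comm]
  · intro p _
    by_contra h
    exact hb ⟨hv, _, lattice_adj_iff.2 ⟨p, rfl⟩, h⟩

open Classical in
theorem filter_mem_edge {Λ : Finset (Fin d → ℤ)} {e : LatticeEdge d} (he : e ∈ edgesIn d Λ) :
    (Λ.filter fun v => v ∈ (e : Sym2 (Fin d → ℤ))).card = 2 := by
  have h : (Λ.filter fun v => v ∈ (e : Sym2 (Fin d → ℤ))) = (e : Sym2 (Fin d → ℤ)).toFinset := by
    ext v
    simp only [Finset.mem_filter, Sym2.mem_toFinset, and_iff_right_iff_imp]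
    exact mem_edgesIn.1 he v
  rw [h, Sym2.card_toFinset_of_not_isDiag]
  exact SimpleGraph.not_isDiag_of_mem_edgeSet _ e.2

theorem sum_card_edgesAt (Λ : Finset (Fin d → ℤ)) :
    ∑ v ∈ Λ, (edgesAt Λ v).card = 2 * (edgesIn d Λ).card := by
  classical
  have h := Finset.sum_card_bipartiteAbove_eq_sum_card_bipartiteBelow (s := Λ) (t := edgesIn d Λ)
    (fun v (e : LatticeEdge d) => v ∈ (e : Sym2 (Fin d → ℤ)))
  calc _ = _ := h
    _ = ∑ e ∈ edgesIn d Λ, 2 := Finset.sum_congr rfl fun e he => filter_mem_edge he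
    _ = _ := by rw [Finset.sum_const, smul_eq_mul, mul_comm]

open Classical in
-- Two distinct edges share at most one node, so the edges touching `e` split disjointly according
-- to the common end point.
theorem card_filter_adj {Λ : Finset (Fin d → ℤ)} {e : LatticeEdge d} (he : e ∈ edgesIn d Λ) :
    ((edgesIn d Λ).filter fun e' => (edgeGraph d).Adj e e').card =
      ∑ v ∈ Λ with v ∈ (e : Sym2 (Fin d → ℤ)), ((edgesAt Λ v).card - 1) := by
  have h : ((edgesIn d Λ).filter fun e' => (edgeGraph d).Adj e e') =
      (Λ.filter fun v => v ∈ (e : Sym2 (Fin d → ℤ))).biUnion fun v => (edgesAt Λ v).erase e := by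
    ext e'
    simp only [Finset.mem_filter, SimpleGraph.lineGraph_adj_iff_exists, Finset.mem_biUnion,
      Finset.mem_erase, edgesAt]
    constructor
    · rintro ⟨he', hne, v, hv, hv'⟩
      exact ⟨v, ⟨mem_edgesIn.1 he v hv, hv⟩, hne.symm, he', hv'⟩
    · rintro ⟨v, ⟨-, hv⟩, hne, he', hv'⟩
      exact ⟨he', hne.symm, v, hv, hv'⟩
  rw [h, Finset.card_biUnion]
  · refine Finset.sum_congr rfl fun v hv => ?_
    rw [Finset.mem_filter] at hv
    exact Finset.card_erase_of_mem (Finset.mem_filter.2 ⟨he, hv.2⟩)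
  · intro v hv w hw hvw
    rw [Finset.coe_filter, Set.mem_ofPred_eq] at hv hw
    refine Finset.disjoint_left.2 fun e' h1 h2 => ?_
    simp only [Finset.mem_erase, edgesAt, Finset.mem_filter] at h1 h2
    refine h1.1 (Subtype.ext ?_)
    rw [(Sym2.mem_and_mem_iff hvw).1 ⟨h1.2.2, h2.2.2⟩, (Sym2.mem_and_mem_iff hvw).1 ⟨hv.2, hw.2⟩]

open Classical in
-- Both sides count ordered pairs of touching edges: by degrees in the line graph, and by the shared
-- node.
theorem two_mul_card_edgeFinset (Λ : Finset (Fin d → ℤ)) :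
    2 * ((edgeGraph d).comap (fun e : edgesIn d Λ => (e : LatticeEdge d))).edgeFinset.card =
      ∑ v ∈ Λ, (edgesAt Λ v).card * ((edgesAt Λ v).card - 1) := by
  rw [← SimpleGraph.sum_degrees_eq_twice_card_edges]
  have hdeg : ∀ e : edgesIn d Λ,
      ((edgeGraph d).comap (fun e : edgesIn d Λ => (e : LatticeEdge d))).degree e =
      ((edgesIn d Λ).filter fun e' => (edgeGraph d).Adj e e').card := by
    intro e
    rw [← SimpleGraph.card_neighborFinset_eq_degree]
    refine Finset.card_bij (fun e' _ => (e' : LatticeEdge d)) ?_ ?_ ?_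
    · intro e' he'
      rw [SimpleGraph.mem_neighborFinset] at he'
      exact Finset.mem_filter.2 ⟨e'.2, he'⟩
    · intro a _ b _ h
      exact Subtype.ext h
    · intro e' he'
      rw [Finset.mem_filter] at he'
      refine ⟨⟨e', he'.1⟩, ?_, rfl⟩
      rw [SimpleGraph.mem_neighborFinset]
      exact he'.2
  simp_rw [hdeg]
  rw [Finset.sum_coe_sort (edgesIn d Λ)
    fun e => ((edgesIn d Λ).filter fun e' => (edgeGraph d).Adj e e').card,
    Finset.sum_congr rfl fun e he => card_filter_adj he]
  simp_rw [Finset.sum_filter]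
  rw [Finset.sum_comm]
  refine Finset.sum_congr rfl fun v _ => ?_
  rw [← Finset.sum_filter, Finset.sum_const, smul_eq_mul]
  rfl

theorem hasDensity_card_edgesIn (d : ℕ) :
    HasDensity (fun Λ : Finset (Fin d → ℤ) => ((edgesIn d Λ).card : ℝ)) d := by
  have h : HasDensity (fun Λ : Finset (Fin d → ℤ) => ∑ v ∈ Λ, ((edgesAt Λ v).card : ℝ))
      (2 * d) := by
    refine hasDensity_of_abs_le (C := 2 * d) fun Λ => abs_sum_sub_le Λ ?_ ?_
    · intro v hv hb
      rw [card_edgesAt_of_notMem_boundary hv hb]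
      push_cast
      rfl
    · intro v hv
      have : ((edgesAt Λ v).card : ℝ) ≤ 2 * d := by exact_mod_cast card_edgesAt_le hv
      rw [abs_le]
      constructor <;> linarith [Nat.cast_nonneg (α := ℝ) (edgesAt Λ v).card]
  convert h.const_mul (1 / 2) using 1
  · ext Λ
    have := sum_card_edgesAt Λ
    rw [← Nat.cast_sum, this]
    push_cast
    ring
  · ring

open Classical in
theorem hasDensity_card_edgeFinset (d : ℕ) :
    HasDensity (fun Λ : Finset (Fin d → ℤ) => ((((edgeGraph d).comap
      (fun e : edgesIn d Λ => (e : LatticeEdge d))).edgeFinset.card : ℕ) : ℝ))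
      (d * (2 * d - 1)) := by
  have h : HasDensity (fun Λ : Finset (Fin d → ℤ) => ∑ v ∈ Λ,
      (((edgesAt Λ v).card * ((edgesAt Λ v).card - 1) : ℕ) : ℝ))
      ((2 * d * (2 * d - 1) : ℕ) : ℝ) := by
    refine hasDensity_of_abs_le (C := ((2 * d * (2 * d - 1) : ℕ) : ℝ)) fun Λ =>
      abs_sum_sub_le Λ ?_ ?_
    · intro v hv hb
      rw [card_edgesAt_of_notMem_boundary hv hb]
    · intro v hv
      have h1 := card_edgesAt_le hv
      have h2 : (edgesAt Λ v).card * ((edgesAt Λ v).card - 1) ≤ 2 * d * (2 * d - 1) :=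
        Nat.mul_le_mul h1 (Nat.sub_le_sub_right h1 1)
      have h3 : (((edgesAt Λ v).card * ((edgesAt Λ v).card - 1) : ℕ) : ℝ) ≤
        ((2 * d * (2 * d - 1) : ℕ) : ℝ) := by exact_mod_cast h2
      have h4 : (0 : ℝ) ≤ (((edgesAt Λ v).card * ((edgesAt Λ v).card - 1) : ℕ) : ℝ) :=
        Nat.cast_nonneg _
      rw [abs_le]
      constructor <;> linarith
  convert h.const_mul (1 / 2) using 1
  · ext Λ
    rw [← Nat.cast_sum, ← two_mul_card_edgeFinset]
    push_cast
    ring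
  -- For `d = 0` the truncated `2 * d - 1` differs from the real one, but the factor `d` kills both.
  · rcases Nat.eq_zero_or_pos d with rfl | hd
    · simp
    · rw [Nat.cast_mul, Nat.cast_sub (by omega)]
      push_cast
      ring

theorem log_weight_const {V χ : Type*} (G : SimpleGraph V) (M : Model χ) {s : χ}
    (hs : ∀ t, M.H t s ≠ ⊤) (A : Finset V) [DecidableEq A]
    [DecidableRel (G.comap (fun v : A => (v : V))).Adj] :
    Real.log (weight G M A fun _ => s) =
      -((G.comap (fun v : A => (v : V))).edgeFinset.card * (M.H s s).untop (hs s)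
        + A.card * M.h s) := by
  obtain ⟨a, ha, hH⟩ : ∃ a : ℝ, (M.H s s).untop (hs s) = a ∧ M.H s s = (a : WithTop ℝ) :=
    ⟨_, rfl, (WithTop.coe_untop _ _).symm⟩
  have he : energy G M A (fun _ => s) =
      (((G.comap (fun v : A => (v : V))).edgeFinset.card * a + A.card * M.h s : ℝ) :
        WithTop ℝ) := by
    unfold energy
    rw [Finset.sum_const, Finset.card_univ, Fintype.card_coe]
    have h1 : ∀ e : Sym2 A, M.pair (e.map fun _ => s) = (a : WithTop ℝ) := by
      intro e
      rw [← hH]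
      induction e with
      | _ u v => rfl
    simp_rw [h1]
    rw [Finset.sum_const, ← WithTop.coe_nsmul, ← WithTop.coe_nsmul, ← WithTop.coe_add]
    simp only [nsmul_eq_mul]
    congr!
  rw [ha, weight, he, expNeg, if_neg WithTop.coe_ne_top, Real.log_exp]
  rfl

end Counting

/-! ### Asymptotics of the partition function -/

section Pressure

variable {d : ℕ}

/-- Supplies the linear order that the chain rule requires. -/
theorem lexLT_iff_toColex_lt {v u : Fin d → ℤ} : LexLT v u ↔ toColex v < toColex u :=
  ⟨fun ⟨k, h, h'⟩ => ⟨k, h', h⟩, fun ⟨k, h', h⟩ => ⟨k, h, h'⟩⟩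

theorem lexLT_add_right {u v : Fin d → ℤ} : LexLT v (u + v) ↔ LexLT 0 u := by
  unfold LexLT
  refine exists_congr fun k => and_congr (by simp) (forall_congr' fun j => ?_)
  simp [eq_comm]

/-- The edges with an end point in `U` that is later than the origin. -/
def laterEdgesIn (U : Set (Fin d → ℤ)) : Set (LatticeEdge d) :=
  {e | ∃ u ∈ (e : Sym2 (Fin d → ℤ)), LexLT 0 u ∧ u ∈ U}

/-- The edges at the origin. -/
noncomputable def originEdges (d : ℕ) : Finset (LatticeEdge d) :=
  (edges_at_finite (0 : Fin d → ℤ)).toFinset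

theorem mem_originEdges {e : LatticeEdge d} :
    e ∈ originEdges d ↔ (0 : Fin d → ℤ) ∈ (e : Sym2 (Fin d → ℤ)) := by
  simp [originEdges]

variable {χ : Type*} [Fintype χ] {M : Model χ}

/-- In the edge model on `E(Λ)`, the conditional probability that the edges at the origin have
spin `s`, given that those at later nodes in `U` have. -/
noncomputable def originRatio (M : Model χ) (s : χ) (U : Set (Fin d → ℤ))
    (Λ : Finset (Fin d → ℤ)) : ℝ :=
  weightOf (edgeGraph d) M (edgesIn d Λ)
      (cyl _ (originEdges d ∪ laterEdgesIn U) fun _ => s) /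
    weightOf (edgeGraph d) M (edgesIn d Λ) (cyl _ (laterEdgesIn U) fun _ => s)

/-- The translate of `Λ` by `-v`. -/
def recenter (v : Fin d → ℤ) (Λ : Finset (Fin d → ℤ)) : Finset (Fin d → ℤ) :=
  Λ.map (shift (-v)).toEquiv.toEmbedding

theorem mem_recenter {u v : Fin d → ℤ} {Λ : Finset (Fin d → ℤ)} :
    u ∈ recenter v Λ ↔ u + v ∈ Λ := by
  unfold recenter
  rw [Finset.mem_map]
  constructor
  · rintro ⟨w, hw, rfl⟩
    simpa [shift_apply] using hw
  · intro h
    exact ⟨u + v, h, by simp [shift_apply]⟩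

open Classical in
-- Translation by `-v` sends the nodes after `v` to those after the origin and preserves `U`.
-- Restricting the later nodes to `Λ` loses nothing, since edges in `E(Λ)` have both end points
-- there.
theorem originRatio_recenter (M : Model χ) (s : χ) {U : Set (Fin d → ℤ)} {v : Fin d → ℤ}
    (hU : ∀ u, u + v ∈ U ↔ u ∈ U) (Λ : Finset (Fin d → ℤ)) :
    originRatio M s U (recenter v Λ) =
      weightOf (edgeGraph d) M (edgesIn d Λ) (cyl _ ({e | v ∈ (e : Sym2 (Fin d → ℤ))} ∪
        ⋃ j ∈ {j | j ∈ Λ.filter (· ∈ U) ∧ toColex v < toColex j},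
          {e : LatticeEdge d | j ∈ (e : Sym2 (Fin d → ℤ))}) fun _ => s) /
      weightOf (edgeGraph d) M (edgesIn d Λ) (cyl _ (
        ⋃ j ∈ {j | j ∈ Λ.filter (· ∈ U) ∧ toColex v < toColex j},
          {e : LatticeEdge d | j ∈ (e : Sym2 (Fin d → ℤ))}) fun _ => s) := by
  have hΛ : Λ = (recenter v Λ).map (shift v).toEquiv.toEmbedding := by
    ext u
    rw [Finset.mem_map]
    constructor
    · intro h
      exact ⟨u - v, by simpa [mem_recenter] using h, by simp [shift_apply]⟩
    · rintro ⟨w, hw, rfl⟩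
      exact mem_recenter.1 hw
  have hE : edgesIn d Λ =
      (edgesIn d (recenter v Λ)).map (shift v).lineGraph.toEquiv.toEmbedding := by
    rw [← edgesIn_map_shift, ← hΛ]
  have hlater : ∀ e ∈ edgesIn d (recenter v Λ), e ∈ (shift v).lineGraph ⁻¹'
      (⋃ j ∈ {j | j ∈ Λ.filter (· ∈ U) ∧ toColex v < toColex j},
        {e : LatticeEdge d | j ∈ (e : Sym2 (Fin d → ℤ))}) ↔ e ∈ laterEdgesIn U := by
    intro e he
    simp only [Set.mem_preimage, Set.mem_iUnion, Finset.mem_filter, Set.mem_ofPred_eq,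
      coe_shift_lineGraph, Sym2.mem_map, laterEdgesIn, ← lexLT_iff_toColex_lt]
    constructor
    · rintro ⟨_, ⟨⟨_, hjU⟩, hlt⟩, u, hu, rfl⟩
      exact ⟨u, hu, lexLT_add_right.1 hlt, (hU u).1 hjU⟩
    · rintro ⟨u, hu, hlt, huU⟩
      exact ⟨u + v, ⟨⟨mem_recenter.1 (mem_edgesIn.1 he u hu), (hU u).2 huU⟩,
        lexLT_add_right.2 hlt⟩, u, hu, rfl⟩
  have horigin : ∀ e : LatticeEdge d, e ∈ (shift v).lineGraph ⁻¹'
      {e : LatticeEdge d | v ∈ (e : Sym2 (Fin d → ℤ))} ↔ e ∈ (originEdges d : Set _) := by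
    intro e
    rw [Finset.mem_coe, mem_originEdges]
    simp [coe_shift_lineGraph]
  rw [hE, weightOf_map_iso, weightOf_map_iso, cyl_congr hlater, Set.preimage_union, originRatio]
  congr 2
  refine cyl_congr (fun e he => ?_) _
  rw [Set.mem_union, Set.mem_union, hlater e he, horigin]

open Classical in
-- The edges at the nodes of `Λ ∩ U` exhaust `E(Λ)`, so the chain rule ends at the weight of the
-- single configuration `s`.
theorem log_partitionFunction_edgesIn {s : χ} (hs : ∀ t, M.H t s ≠ ⊤) {U : Set (Fin d → ℤ)}
    (hU : ∀ v ∈ U, ∀ u, u + v ∈ U ↔ u ∈ U)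
    (hcover : ∀ e : LatticeEdge d, ∃ u ∈ (e : Sym2 (Fin d → ℤ)), u ∈ U)
    (Λ : Finset (Fin d → ℤ)) :
    Real.log (partitionFunction (edgeGraph d) M (edgesIn d Λ)) =
      Real.log (weight (edgeGraph d) M (edgesIn d Λ) fun _ => s) -
        ∑ v ∈ Λ with v ∈ U, Real.log (originRatio M s U (recenter v Λ)) := by
  have h := sum_log_weightOf_div (toColex (α := Fin d → ℤ)).injective (edgeGraph d) hs
    (edgesIn d Λ)
    (fun v => {e | v ∈ (e : Sym2 (Fin d → ℤ))}) (Λ.filter (· ∈ U))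
  have h1 : ∀ v ∈ Λ.filter (· ∈ U), Real.log (originRatio M s U (recenter v Λ)) = _ :=
    fun v hv => congrArg Real.log (originRatio_recenter M s (hU v (Finset.mem_filter.1 hv).2) Λ)
  have h2 : cyl (edgesIn d Λ) (⋃ j ∈ Λ.filter (· ∈ U),
      {e : LatticeEdge d | j ∈ (e : Sym2 (Fin d → ℤ))}) (fun _ => s) = {fun _ => s} := by
    ext τ
    rw [Set.mem_singleton_iff]
    constructor
    · intro hτ
      ext e
      obtain ⟨u, hu, huU⟩ := hcover e
      refine hτ e ?_
      simp only [Set.mem_iUnion, Finset.mem_filter]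
      exact ⟨u, ⟨mem_edgesIn.1 e.2 u hu, huU⟩, hu⟩
    · rintro rfl _ _
      rfl
  rw [h2, weightOf_singleton] at h
  have h3 := (Finset.sum_congr rfl h1).trans h
  rw [h3]
  ring

open Classical in
/-- The asymptotics of the partition function in terms of the conditional probability of the spins
at the origin, where the nodes are revealed along a sublattice `U` that covers the edges. -/
theorem hasDensity_log_partitionFunction {s : χ} (hs : ∀ t, M.H t s ≠ ⊤) {U : Set (Fin d → ℤ)}
    (hU : ∀ v ∈ U, ∀ u, u + v ∈ U ↔ u ∈ U)
    (hcover : ∀ e : LatticeEdge d, ∃ u ∈ (e : Sym2 (Fin d → ℤ)), u ∈ U) {κ p : ℝ}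
    (hκ : HasDensity (fun Λ : Finset (Fin d → ℤ) => ((Λ.filter (· ∈ U)).card : ℝ)) κ)
    (hp : 0 < p) (happrox : ∀ ε > 0, ∃ B : Finset (LatticeEdge d), ∀ A, B ⊆ A →
      ∀ F : Set (LatticeEdge d), (∀ e ∈ B, e ∈ F ↔ e ∈ laterEdgesIn U) →
        |weightOf (edgeGraph d) M A (cyl A (originEdges d ∪ F) fun _ => s) /
          weightOf (edgeGraph d) M A (cyl A F fun _ => s) - p| ≤ ε) :
    HasDensity (fun Λ : Finset (Fin d → ℤ) =>
      Real.log (partitionFunction (edgeGraph d) M (edgesIn d Λ)))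
      (-κ * Real.log p - d * (2 * d - 1) * (M.H s s).untop (hs s) - d * M.h s) := by
  obtain ⟨c, hc, hlow⟩ := exists_pos_le_mass edgeGraph_neighborSet_finite hs (originEdges d)
  have hg1 : ∀ Λ, c ≤ originRatio M s U Λ := by
    intro Λ
    rw [originRatio, le_div_iff₀ (weightOf_cyl_const_pos _ hs _ _), ← cyl_inter_cyl]
    exact hlow _ _ (isLocallyGibbs_weight _ M _ _) _
  have hg2 : ∀ Λ, originRatio M s U Λ ≤ 1 := by
    intro Λ
    rw [originRatio, ← cyl_inter_cyl]
    exact div_le_one_of_le₀ (mass_mono (weight_nonneg _ M _) Set.inter_subset_right)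
      (weightOf_cyl_const_pos _ hs _ _).le
  have hK : ∀ Λ, |Real.log (originRatio M s U Λ) - Real.log p| ≤ |Real.log c| + |Real.log p| := by
    intro Λ
    refine (abs_sub _ _).trans (add_le_add_left ?_ _)
    have h1 := Real.log_le_log hc (hg1 Λ)
    have h2 := Real.log_nonpos (hc.le.trans (hg1 Λ)) (hg2 Λ)
    rw [abs_of_nonpos h2, abs_of_nonpos (h1.trans h2)]
    linarith
  have hzero : HasDensity (fun Λ : Finset (Fin d → ℤ) => ∑ v ∈ Λ with v ∈ U,
      (Real.log (originRatio M s U (recenter v Λ)) - Real.log p)) 0 := by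
    intro ε hε
    obtain ⟨δ, hδ, hlog⟩ := Metric.continuousAt_iff.1 (Real.continuousAt_log hp.ne') ε hε
    obtain ⟨B, hB⟩ := happrox (δ / 2) (half_pos hδ)
    -- A node `v` is good if `v` plus each end point of an edge of `B` lies in `Λ`; then `B` sits
    -- inside the recentred system. The number of bad nodes is at most a multiple of the boundary.
    obtain ⟨C, hC⟩ := exists_card_escape_finset_le
      (B.biUnion fun e => (e : Sym2 (Fin d → ℤ)).toFinset)
    refine ⟨(|Real.log c| + |Real.log p|) * C, fun Λ => ?_⟩
    rw [zero_mul, sub_zero]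
    have hterm : ∀ v ∈ Λ, |Real.log (originRatio M s U (recenter v Λ)) - Real.log p| ≤
        ε + if ∃ x ∈ B.biUnion fun e => (e : Sym2 (Fin d → ℤ)).toFinset, v + x ∉ Λ
          then |Real.log c| + |Real.log p| else 0 := by
      intro v _
      split_ifs with hbad
      · exact (hK _).trans (le_add_of_nonneg_left hε.le)
      · rw [add_zero]
        push Not at hbad
        refine (hlog ?_).le
        rw [Real.dist_eq]
        refine (hB (edgesIn d (recenter v Λ)) ?_ _ fun _ _ => Iff.rfl).trans_lt (half_lt_self hδ)
        intro e he
        refine mem_edgesIn.2 fun u hu => mem_recenter.2 ?_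
        rw [add_comm]
        exact hbad u (Finset.mem_biUnion.2 ⟨e, he, Sym2.mem_toFinset.2 hu⟩)
    calc _ ≤ ∑ v ∈ Λ with v ∈ U, |Real.log (originRatio M s U (recenter v Λ)) - Real.log p| :=
          Finset.abs_sum_le_sum_abs _ _
      _ ≤ ∑ v ∈ Λ, |Real.log (originRatio M s U (recenter v Λ)) - Real.log p| :=
          Finset.sum_le_sum_of_subset_of_nonneg (Finset.filter_subset _ _)
            fun _ _ _ => abs_nonneg _
      _ ≤ _ := Finset.sum_le_sum hterm
      _ = ε * Λ.card + (|Real.log c| + |Real.log p|) * (Λ.filter fun v =>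
            ∃ x ∈ B.biUnion fun e => (e : Sym2 (Fin d → ℤ)).toFinset, v + x ∉ Λ).card := by
          rw [Finset.sum_add_distrib, Finset.sum_const, ← Finset.sum_filter, Finset.sum_const,
            nsmul_eq_mul, nsmul_eq_mul]
          ring
      _ ≤ ε * Λ.card + (|Real.log c| + |Real.log p|) * (C * boundaryCard Λ : ℕ) := by
          gcongr
          exact hC Λ
      _ = _ := by
          push_cast
          ring
  have hmain := ((hzero.add (hκ.const_mul (Real.log p))).const_mul (-1)).add
    (((hasDensity_card_edgeFinset d).const_mul (-(M.H s s).untop (hs s))).add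
      ((hasDensity_card_edgesIn d).const_mul (-M.h s)))
  convert hmain using 1
  · ext Λ
    rw [log_partitionFunction_edgesIn hs hU hcover, log_weight_const _ M hs,
      Finset.sum_sub_distrib, Finset.sum_const, nsmul_eq_mul]
    ring
  · ring

/-- The nodes with an even sum of coordinates. -/
def evenNodes (d : ℕ) : Set (Fin d → ℤ) := {u | Even (∑ i, u i)}

theorem add_unitVector_mem_evenNodes (v : Fin d → ℤ) (q : Fin d × Bool) :
    v + unitVector q ∈ evenNodes d ↔ v ∉ evenNodes d := by
  change Even (∑ i, (v + unitVector q) i) ↔ ¬ Even (∑ i, v i)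
  obtain ⟨j, b⟩ := q
  have h : ∑ i, (v + unitVector (j, b)) i = ∑ i, v i + if b then 1 else -1 := by
    simp [Finset.sum_add_distrib, unitVector]
  rw [h]
  cases b <;> simp [parity_simps]

open Classical in
-- A unit step maps even nodes injectively to odd ones and conversely, except where it leaves `Λ`.
-- So the two counts differ by at most the number of boundary nodes.
theorem hasDensity_card_even (hd : 0 < d) :
    HasDensity (fun Λ : Finset (Fin d → ℤ) =>
      ((Λ.filter (· ∈ evenNodes d)).card : ℝ)) (1 / 2) := by
  refine hasDensity_of_abs_le (C := 1) fun Λ => ?_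
  -- A unit vector exists only if `d > 0`; in dimension zero the single node is even.
  let q : Fin d × Bool := (⟨0, hd⟩, true)
  have hle : ∀ (P Q : (Fin d → ℤ) → Prop) [DecidablePred P] [DecidablePred Q], (∀ v, P v → Q (v + unitVector q)) →
      (Λ.filter P).card ≤ (Λ.filter Q).card + boundaryCard Λ := by
    intro P Q _ _ hPQ
    have hsub : Λ.filter P ⊆ ((Λ.filter Q).image (· - unitVector q)) ∪
        Λ.filter (· ∈ boundary (lattice d) (Λ : Set (Fin d → ℤ))) := by
      intro v hv
      rw [Finset.mem_filter] at hv
      rw [Finset.mem_union, Finset.mem_image, Finset.mem_filter]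
      by_cases h : v + unitVector q ∈ Λ
      · exact .inl ⟨_, Finset.mem_filter.2 ⟨h, hPQ v hv.2⟩, by simp⟩
      · exact .inr ⟨hv.1, hv.1, _, lattice_adj_iff.2 ⟨q, rfl⟩, h⟩
    exact (Finset.card_le_card hsub).trans ((Finset.card_union_le _ _).trans
      (Nat.add_le_add_right Finset.card_image_le _))
  have h1 := hle (· ∈ evenNodes d) (· ∉ evenNodes d)
    fun v hv h => (add_unitVector_mem_evenNodes v q).1 h hv
  have h2 := hle (· ∉ evenNodes d) (· ∈ evenNodes d)
    fun v hv => (add_unitVector_mem_evenNodes v q).2 hv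
  have h3 := Finset.card_filter_add_card_filter_not (s := Λ) (· ∈ evenNodes d)
  have h1' : ((Λ.filter (· ∈ evenNodes d)).card : ℝ) ≤
    (Λ.filter (· ∉ evenNodes d)).card + boundaryCard Λ := by exact_mod_cast h1
  have h2' : ((Λ.filter (· ∉ evenNodes d)).card : ℝ) ≤
    (Λ.filter (· ∈ evenNodes d)).card + boundaryCard Λ := by exact_mod_cast h2
  have h3' : ((Λ.filter (· ∈ evenNodes d)).card : ℝ) +
    (Λ.filter (· ∉ evenNodes d)).card = Λ.card := by exact_mod_cast h3
  have h4 : (0 : ℝ) ≤ boundaryCard Λ := Nat.cast_nonneg _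
  rw [abs_le]
  constructor <;> linarith

theorem exists_edge_even (e : LatticeEdge d) :
    ∃ u ∈ (e : Sym2 (Fin d → ℤ)), u ∈ evenNodes d := by
  obtain ⟨e, he⟩ := e
  induction e with
  | _ v w =>
    obtain ⟨q, hq⟩ := lattice_adj_iff.1 (show (lattice d).Adj v w from he)
    by_cases h : v ∈ evenNodes d
    · exact ⟨v, Sym2.mem_mk_left _ _, h⟩
    · exact ⟨w, Sym2.mem_mk_right _ _, by
        rw [hq]
        exact (add_unitVector_mem_evenNodes v q).2 h⟩

/-- The boxes have small boundaries. -/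
theorem exists_tendsto_boundary_div_card (d : ℕ) : ∃ Λ : ℕ → Finset (Fin d → ℤ),
    (∀ n, (Λ n).Nonempty) ∧
    Tendsto (fun n => ((boundary (lattice d) (Λ n : Set (Fin d → ℤ))).ncard : ℝ) / (Λ n).card)
      atTop (𝓝 0) := by
  classical
  -- The box `Δ n` of side `n` is `Λ n` with its outer layer removed, so it contains no boundary
  -- node of `Λ n`. Side `n + 2` keeps `Λ n` nonempty for `n = 0`.
  let Λ : ℕ → Finset (Fin d → ℤ) := fun n => Fintype.piFinset fun _ => Finset.Ico 0 ((n : ℤ) + 2)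
  let Δ : ℕ → Finset (Fin d → ℤ) := fun n => Fintype.piFinset fun _ => Finset.Ico 1 ((n : ℤ) + 1)
  have hΛ : ∀ n, (Λ n).card = (n + 2) ^ d := by
    intro n
    simp only [Λ, Fintype.card_piFinset, Int.card_Ico, Finset.prod_const, Finset.card_univ,
      Fintype.card_fin]
    congr 1
  have hΔ : ∀ n, (Δ n).card = n ^ d := by
    intro n
    have h : (((n : ℤ) + 1) - 1).toNat = n := by omega
    simp only [Δ, Fintype.card_piFinset, Int.card_Ico, Finset.prod_const, Finset.card_univ,
      Fintype.card_fin, h]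
  have hΔΛ : ∀ n, Δ n ⊆ Λ n := by
    intro n
    refine Fintype.piFinset_subset _ _ fun _ => Finset.Ico_subset_Ico ?_ ?_ <;> omega
  have hb : ∀ n, boundaryCard (Λ n) + n ^ d ≤ (n + 2) ^ d := by
    intro n
    rw [← hΛ, ← hΔ, boundaryCard, ← Finset.card_sdiff_add_card_eq_card (hΔΛ n)]
    refine Nat.add_le_add_right (Finset.card_le_card fun v hv => ?_) _
    rw [Finset.mem_filter] at hv
    refine Finset.mem_sdiff.2 ⟨hv.1, fun hvΔ => ?_⟩
    obtain ⟨-, -, u, hvu, hu⟩ := hv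
    obtain ⟨⟨i, b⟩, rfl⟩ := lattice_adj_iff.1 hvu
    refine hu (Finset.mem_coe.2 (Fintype.mem_piFinset.2 fun j => ?_))
    have := Finset.mem_Ico.1 (Fintype.mem_piFinset.1 hvΔ j)
    rw [Finset.mem_Ico]
    by_cases hj : j = i
    · subst hj
      cases b <;> simp [unitVector] <;> omega
    · simp [unitVector, hj]
      omega
  refine ⟨Λ, fun n => ?_, ?_⟩
  · rw [← Finset.card_pos, hΛ]
    positivity
  · have h1 : Tendsto (fun n : ℕ => 1 - ((n : ℝ) / (n + 2)) ^ d) atTop (𝓝 0) := by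
      simpa using ((tendsto_natCast_div_add_atTop (2 : ℝ)).pow d).const_sub 1
    refine squeeze_zero (fun n => by positivity) (fun n => ?_) h1
    rw [boundary_ncard, hΛ, div_pow, div_le_iff₀ (by positivity)]
    have h2 : (boundaryCard (Λ n) : ℝ) + (n : ℝ) ^ d ≤ ((n : ℝ) + 2) ^ d := by exact_mod_cast hb n
    have h3 : ((n : ℝ) + 2) ^ d ≠ 0 := by positivity
    push_cast
    rw [sub_mul, div_mul_cancel₀ _ h3]
    linarith

end Pressure

end SpinSystem

/-! ### Assembly of the two formulas -/

theorem theorem3 {χ : Type*} [Fintype χ] [MeasurableSpace χ] [DiscreteMeasurableSpace χ]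
    (d : ℕ) (hd : 0 < d) (M : SpinSystem.Model χ) (sstar : χ)
    (hstar : ∀ s : χ, M.H s sstar ≠ ⊤)
    (hSSM : SpinSystem.StrongSpatialMixing (SpinSystem.edgeGraph d) M) :
    (∃! μ : Measure (SpinSystem.LatticeEdge d → χ),
        SpinSystem.IsGibbsMeasure (SpinSystem.edgeGraph d) M μ) ∧
      ∀ μ : Measure (SpinSystem.LatticeEdge d → χ),
        SpinSystem.IsGibbsMeasure (SpinSystem.edgeGraph d) M μ →
        ∃ P p pEven : ℝ, 0 < p ∧ 0 < pEven ∧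
          SpinSystem.HasCondProb μ (SpinSystem.originEvent d sstar)
            (SpinSystem.laterEdges d) sstar p ∧
          SpinSystem.HasCondProb μ (SpinSystem.originEvent d sstar)
            (SpinSystem.laterEvenEdges d) sstar pEven ∧
          SpinSystem.IsPressure d M P ∧
          P = -Real.log p
              - d * (2 * d - 1) * (M.H sstar sstar).untop (hstar sstar) - d * M.h sstar ∧
          P = -(1 / 2) * Real.log pEven
              - d * (2 * d - 1) * (M.H sstar sstar).untop (hstar sstar) - d * M.h sstar := by
  classical
  have hG := SpinSystem.edgeGraph_neighborSet_finite (d := d)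
  refine ⟨?_, fun μ hμ => ?_⟩
  · obtain ⟨μ, hμ⟩ := SpinSystem.exists_isGibbsMeasure (SpinSystem.edgeGraph d) hstar
    exact ⟨μ, hμ, fun ν hν => hν.unique hSSM hG hstar hμ⟩
  · have hevent : SpinSystem.originEvent d sstar =
        {ω | ∀ e ∈ SpinSystem.originEdges d, ω e = sstar} := by
      ext ω
      simp [SpinSystem.originEvent, SpinSystem.mem_originEdges]
    have hlater : SpinSystem.laterEdges d = SpinSystem.laterEdgesIn Set.univ := by
      ext e
      simp [SpinSystem.laterEdges, SpinSystem.laterEdgesIn]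
    have hlaterEven : SpinSystem.laterEvenEdges d =
        SpinSystem.laterEdgesIn (SpinSystem.evenNodes d) := rfl
    rw [hevent, hlater, hlaterEven]
    obtain ⟨p, hp, hpcond, hpapprox⟩ := hμ.exists_hasCondProb hSSM hG hstar
      (SpinSystem.originEdges d) (SpinSystem.laterEdgesIn Set.univ)
    obtain ⟨q, hq, hqcond, hqapprox⟩ := hμ.exists_hasCondProb hSSM hG hstar
      (SpinSystem.originEdges d) (SpinSystem.laterEdgesIn (SpinSystem.evenNodes d))
    have hfull := SpinSystem.hasDensity_log_partitionFunction hstar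
      (U := (Set.univ : Set (Fin d → ℤ))) (by simp)
      (fun e => ⟨_, Sym2.out_fst_mem _, Set.mem_univ _⟩) (κ := 1)
      (SpinSystem.hasDensity_of_abs_le (C := 0) fun Λ => by simp) hp hpapprox
    have heven := SpinSystem.hasDensity_log_partitionFunction hstar
      (U := SpinSystem.evenNodes d) (by
        intro v hv u
        have hv' : Even (∑ i, v i) := hv
        simp [SpinSystem.evenNodes, Finset.sum_add_distrib, Int.even_add, hv'])
      SpinSystem.exists_edge_even (SpinSystem.hasDensity_card_even hd) hq hqapprox
    -- Both expressions are limits of the same quotients along the boxes, hence equal; one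
    -- admissible sequence suffices.
    obtain ⟨Λ, hΛ, hb⟩ := SpinSystem.exists_tendsto_boundary_div_card d
    have heq := tendsto_nhds_unique (hfull.tendsto hΛ hb) (heven.tendsto hΛ hb)
    refine ⟨_, p, q, hp, hq, hpcond, hqcond, fun Λ hΛ hb => hfull.tendsto hΛ hb, ?_, heq⟩
    ring
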